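/- Let $C$ be the unit circle in the horizontal plane of $\mathbb{R}^3$, and place the vertices $1,\dots,6$ of the complete graph $K_6$ on $C$, equally spaced and in clockwise order. Two edges of $K_6$ cross if, as chords of $C$, they have four distinct endpoints that alternate along $C$. An $s$-sheet book representation of $K_6$ is an assignment of the edges of $K_6$ to sheets $1,\dots,s$ such that no two edges in the same sheet cross. (Edges joining consecutive vertices cross no other edge and may be assigned to any sheet; the remaining nine edges are called interior.) It determines a spatial graph in $\mathbb{R}^3$: take $s$ disks with common boundary $C$ and pairwise disjoint interiors, stacked from top to bottom in the order $1,\dots,s$, each the graph of a continuous function on the closed unit disk vanishing on $C$; each edge is drawn in its sheet as the arc that projects vertically onto the corresponding chord. Two spatial graphs are ambient isotopic if there is a continuous family of homeomorphisms $H_t$ ($0\le t\le 1$) of $\mathbb{R}^3$, with $H_0$ the identity, such that $H_1$ carries the vertices and edges of the first onto the vertices and edges of the second (vertex labels need not be preserved). Theorem. Every 3-sheet book representation of $K_6$ is ambient isotopic, for any choice of the stacked disks, to the canonical book representation of $K_6$, in which the interior edges are distributed as follows: sheet 1 contains $13, 14, 46$; sheet 2 contains $15, 24, 25$; sheet 3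 contains $26, 35, 36$. Moreover, 3 is the smallest number of sheets of a book representation of $K_6$, so that up to ambient isotopy there is a unique book representation of $K_6$ with the minimal number of sheets; and this representation is achiral, that is, ambient isotopic to its mirror image. -/

import Mathlib

namespace BookRep

/-- Three-dimensional space, as (horizontal plane) × (vertical axis). The boundary circle `C` is the
unit circle of the plane `ℂ × {0}`. -/
abbrev Space : Type := ℂ × ℝ

/-! ### Spatial graphs and ambient isotopy -/

/-- The spatial graph traced out by a graph drawn in space: the set of its vertices and the set of
its edges, each edge being a subset of space (an arc). The vertices carry no labels. -/
structure SpatialGraph where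
  vertices : Set Space
  edges : Set (Set Space)

/-- The image of a spatial graph under a map of space. -/
def SpatialGraph.map (h : Space → Space) (G : SpatialGraph) : SpatialGraph where
  vertices := h '' G.vertices
  edges := (fun e => h '' e) '' G.edges

/-- `G` and `G'` are ambient isotopic: there is a continuous family of homeomorphisms of space that
starts at the identity and ends at a homeomorphism that carries the vertices of `G` onto those of
`G'` and the edges of `G` onto those of `G'`. -/
def AmbientIsotopic (G G' : SpatialGraph) : Prop :=
  ∃ H : unitInterval → (Space ≃ₜ Space),
    Continuous (fun p : unitInterval × Space => H p.1 p.2) ∧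
    H 0 = Homeomorph.refl Space ∧
    G.map (H 1) = G'

/-- The mirror image of a spatial graph: its reflection in the plane of the boundary circle. -/
def SpatialGraph.mirror (G : SpatialGraph) : SpatialGraph :=
  G.map (fun x => (x.1, -x.2))

/-! ### Book representations of complete graphs -/

/-- The edges of the complete graph `K_n`. Its vertices are the residues modulo `n`, so that the
label `n` is the residue `0`. -/
abbrev Edge (n : ℕ) : Type := (⊤ : SimpleGraph (Fin n)).edgeSet

/-- Two edges cross when, as chords of the circle, their endpoints are four distinct vertices that
alternate along the circle. -/
def Crosses {n : ℕ} (e f : Edge n) : Prop :=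
  ∃ a b c d : Fin n, a < b ∧ b < c ∧ c < d ∧
    ((e.1 = s(a, c) ∧ f.1 = s(b, d)) ∨ (e.1 = s(b, d) ∧ f.1 = s(a, c)))

/-- A book representation of `K_n` with `s` sheets: the edges are distributed among the sheets so
that edges in the same sheet do not cross. (An exterior edge, one that joins consecutive vertices,
crosses no edge and may lie in any sheet.) -/
structure BookRepresentation (n s : ℕ) where
  sheet : Edge n → Fin s
  sheet_ne : ∀ e f : Edge n, Crosses e f → sheet e ≠ sheet f

/-- A stack of `s` disks with common boundary the unit circle and otherwise disjoint, each of them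
the graph of a function on the closed unit disk; sheets are numbered from the top downwards. -/
structure SheetStack (s : ℕ) where
  height : Fin s → ℂ → ℝ
  continuousOn_height : ∀ i, ContinuousOn (height i) (Metric.closedBall 0 1)
  height_boundary : ∀ i, ∀ p ∈ Metric.sphere (0 : ℂ) 1, height i p = 0
  height_lt : ∀ i j, i < j → ∀ p ∈ Metric.ball (0 : ℂ) 1, height j p < height i p

/-- The position of a vertex: the vertices are equally spaced on the unit circle and numbered
clockwise, seen from above. -/
noncomputable def vertexPos {n : ℕ} (k : Fin n) : ℂ :=
  Complex.exp (-(2 * Real.pi * ((k : ℕ) : ℂ) / n) * Complex.I)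

/-- The chord of the circle onto which an edge projects. -/
noncomputable def chord {n : ℕ} : Sym2 (Fin n) → Set ℂ :=
  Sym2.lift ⟨fun a b => segment ℝ (vertexPos a) (vertexPos b), fun _ _ => segment_symm ℝ _ _⟩

/-- The spatial graph given by a book representation and a stack of sheets: each edge is the arc
over its chord in the sheet to which it is assigned. -/
noncomputable def BookRepresentation.spatialGraph {n s : ℕ} (B : BookRepresentation n s)
    (F : SheetStack s) : SpatialGraph where
  vertices := Set.range fun k : Fin n => ((vertexPos k, 0) : Space)
  edges := Set.range fun e : Edge n =>
    (fun p : ℂ => ((p, F.height (B.sheet e) p) : Space)) '' chord e.1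

/-- The canonical book representation of `K_6`, with interior edges
13, 14, 46 in the first sheet, 15, 24, 25 in the second and 26, 35, 36 in the third. The exterior
edges are put in the first sheet. -/
def canonicalK6 : BookRepresentation 6 3 where
  sheet e :=
    if e.1 = s(1, 5) ∨ e.1 = s(2, 4) ∨ e.1 = s(2, 5) then 1
    else if e.1 = s(2, 6) ∨ e.1 = s(3, 5) ∨ e.1 = s(3, 6) then 2
    else 0
  sheet_ne := by
    have key : ∀ a b c d : Fin 6, a < b → b < c → c < d →
        (if s(a, c) = s(1, 5) ∨ s(a, c) = s(2, 4) ∨ s(a, c) = s(2, 5) then (1 : Fin 3)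
          else if s(a, c) = s(2, 6) ∨ s(a, c) = s(3, 5) ∨ s(a, c) = s(3, 6) then 2 else 0) ≠
        (if s(b, d) = s(1, 5) ∨ s(b, d) = s(2, 4) ∨ s(b, d) = s(2, 5) then (1 : Fin 3)
          else if s(b, d) = s(2, 6) ∨ s(b, d) = s(3, 5) ∨ s(b, d) = s(3, 6) then 2 else 0) := by
      decide
    rintro ⟨e, he⟩ ⟨f, hf⟩ ⟨a, b, c, d, hab, hbc, hcd, ⟨h1, h2⟩ | ⟨h1, h2⟩⟩
    · simp only at h1 h2
      subst h1 h2
      exact key a b c d hab hbc hcd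
    · simp only at h1 h2
      subst h1 h2
      exact (key a b c d hab hbc hcd).symm

end BookRep

/-!
Throughout, spatial graphs are handled as families of sets indexed by unordered pairs of labels:
proper pairs give the edges, the pairs `s(k, k)` the vertices. An isotopy of families is then an
isotopy of spatial graphs, and a permutation of the labels does not change the graph. The label `6`
is the residue `0`.

**Moving arcs vertically.** The main tool is `exists_isotopy_raise`: a piece of a graph over the
plane can be pushed upwards by an ambient isotopy that fixes a given closed set, provided it does
not hit that set on its way. The isotopy preserves every vertical line; on it, it is piecewise
linear, with a clearance given by the distance to the fixed set. Moving the arcs of a family one at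
a time shows that two families of arcs over the same plane drawing are isotopic as soon as both are
ordered at the crossings by the same ranking (`familyIsotopic_of_compatible`). Since distinct chords
of the hexagon meet only at common ends or at crossings (`common_vertex_or_cross`), a book
representation depends only on the sheets of the interior edges, not on the stack of disks
(`sheetFamily_isotopic`).

**The assignments.** The interior edges can be distributed among three sheets in exactly twelve
ways. They are permuted transitively by the symmetries of the hexagon together with the reversal of
the sheets (`exists_transformedSheet`). Rotations of the hexagon extend to rotations of space; a
reflection of the hexagon combined with a reversal of the sheets extends to a half-turn about a
horizontal axis; a mere reversal of the sheets is the mirror image. Hence everything follows once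
the canonical representation is known to be achiral.

**Achirality.** In the canonical representation the edge `13` lies above all edges that it crosses,
so it can be swung over the vertex `2` to the outside of the circle. Afterwards the complete graph
on `1`, `2`, `3`, `5` lies flat in the horizontal plane, up to vertical moves. All other edges at
the vertex `4` lie above it and all other edges at `6` lie below it, except that `46` passes through
the plane beyond the chord `15`. Lifting `4`, lowering `6` and sliding `4` to a place vertically
above `6` produces a graph that is visibly symmetric with respect to the plane, the reflection
exchanging `4` and `6` (`canonical_isotopic_model`, `mirror_model`).

The coordinates of the plane are taken with respect to the vertices `0` and `1` of the hexagon, so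
that all vertices have integer coordinates and the finite checks are decidable.
-/

namespace BookRep

open Set Filter Topology

/-! ### Ambient isotopies -/

/-- A continuous family of homeomorphisms of space that starts at the identity. -/
def IsAmbientIsotopy (H : unitInterval → (Space ≃ₜ Space)) : Prop :=
  Continuous (fun p : unitInterval × Space => H p.1 p.2) ∧ H 0 = Homeomorph.refl Space

theorem IsAmbientIsotopy.refl : IsAmbientIsotopy fun _ => Homeomorph.refl Space :=
  ⟨continuous_snd, rfl⟩

/-- Two isotopies are performed simultaneously rather than consecutively, which avoids a
reparametrisation of time. -/
theorem IsAmbientIsotopy.trans {H K : unitInterval → (Space ≃ₜ Space)} (hH : IsAmbientIsotopy H)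
    (hK : IsAmbientIsotopy K) : IsAmbientIsotopy fun t => (H t).trans (K t) := by
  refine ⟨?_, ?_⟩
  · exact hK.1.comp (continuous_fst.prodMk hH.1)
  · ext1 x
    simp [hH.2, hK.2]

/-- Running an isotopy backwards from its end only involves the inverse of a single
homeomorphism, so no continuity of inverses in the time parameter is needed. -/
theorem IsAmbientIsotopy.symm {H : unitInterval → (Space ≃ₜ Space)} (hH : IsAmbientIsotopy H) :
    IsAmbientIsotopy fun t => (H 1).symm.trans (H (unitInterval.symm t)) := by
  refine ⟨?_, ?_⟩
  · exact hH.1.comp ((unitInterval.continuous_symm.comp continuous_fst).prodMk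
      ((H 1).symm.continuous.comp continuous_snd))
  · ext1 x
    simp

theorem IsAmbientIsotopy.conj {H : unitInterval → (Space ≃ₜ Space)} (hH : IsAmbientIsotopy H)
    (g : Space ≃ₜ Space) : IsAmbientIsotopy fun t => (g.symm.trans (H t)).trans g := by
  refine ⟨?_, ?_⟩
  · exact g.continuous.comp (hH.1.comp (continuous_fst.prodMk
      (g.symm.continuous.comp continuous_snd)))
  · ext1 x
    simp [hH.2]

theorem ambientIsotopic_iff {G G' : SpatialGraph} :
    AmbientIsotopic G G' ↔ ∃ H, IsAmbientIsotopy H ∧ G.map (H 1) = G' := by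
  simp only [AmbientIsotopic, IsAmbientIsotopy, and_assoc]

theorem SpatialGraph.map_map (f g : Space → Space) (G : SpatialGraph) :
    (G.map f).map g = G.map (g ∘ f) := by
  simp [SpatialGraph.map, image_image]

theorem SpatialGraph.map_id (G : SpatialGraph) : G.map (fun x => x) = G := by
  simp [SpatialGraph.map]

theorem AmbientIsotopic.trans {G G' G'' : SpatialGraph} (h : AmbientIsotopic G G')
    (h' : AmbientIsotopic G' G'') : AmbientIsotopic G G'' := by
  rw [ambientIsotopic_iff] at *
  obtain ⟨H, hH, rfl⟩ := h
  obtain ⟨K, hK, rfl⟩ := h'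
  exact ⟨_, hH.trans hK, by rw [SpatialGraph.map_map]; rfl⟩

theorem AmbientIsotopic.symm {G G' : SpatialGraph} (h : AmbientIsotopic G G') :
    AmbientIsotopic G' G := by
  rw [ambientIsotopic_iff] at *
  obtain ⟨H, hH, rfl⟩ := h
  refine ⟨_, hH.symm, ?_⟩
  rw [SpatialGraph.map_map]
  convert G.map_id using 2
  funext x
  simp [hH.2]

theorem AmbientIsotopic.map {G G' : SpatialGraph} (h : AmbientIsotopic G G')
    (g : Space ≃ₜ Space) : AmbientIsotopic (G.map g) (G'.map g) := by
  rw [ambientIsotopic_iff] at *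
  obtain ⟨H, hH, rfl⟩ := h
  refine ⟨_, hH.conj g, ?_⟩
  rw [SpatialGraph.map_map, SpatialGraph.map_map]
  congr 1
  funext x
  simp

/-- The reflection of space in the plane of the boundary circle. -/
noncomputable def mirrorHomeo : Space ≃ₜ Space :=
  (Homeomorph.refl ℂ).prodCongr (Homeomorph.neg ℝ)

theorem SpatialGraph.mirror_mirror (G : SpatialGraph) : G.mirror.mirror = G := by
  rw [SpatialGraph.mirror, SpatialGraph.mirror, SpatialGraph.map_map]
  convert G.map_id using 2
  funext x
  simp

theorem AmbientIsotopic.mirror {G G' : SpatialGraph} (h : AmbientIsotopic G G') :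
    AmbientIsotopic G.mirror G'.mirror :=
  h.map mirrorHomeo

/-! ### Families of subsets of space -/

/-- One ambient isotopy carries every member of the first family onto the member of the second
family with the same index. -/
def FamilyIsotopic {ι : Type*} (S S' : ι → Set Space) : Prop :=
  ∃ H, IsAmbientIsotopy H ∧ ∀ i, H 1 '' S i = S' i

theorem FamilyIsotopic.refl {ι : Type*} (S : ι → Set Space) : FamilyIsotopic S S :=
  ⟨_, IsAmbientIsotopy.refl, fun i => by simp⟩

theorem FamilyIsotopic.trans {ι : Type*} {S S' S'' : ι → Set Space} (h : FamilyIsotopic S S')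
    (h' : FamilyIsotopic S' S'') : FamilyIsotopic S S'' := by
  obtain ⟨H, hH, h⟩ := h
  obtain ⟨K, hK, h'⟩ := h'
  refine ⟨_, hH.trans hK, fun i => ?_⟩
  rw [← h' i, ← h i, image_image]
  rfl

theorem FamilyIsotopic.symm {ι : Type*} {S S' : ι → Set Space} (h : FamilyIsotopic S S') :
    FamilyIsotopic S' S := by
  obtain ⟨H, hH, h⟩ := h
  refine ⟨_, hH.symm, fun i => ?_⟩
  rw [← h i, image_image]
  simp [hH.2]

/-- The spatial graph of a family of sets indexed by unordered pairs of labels: the members at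
`s(k, k)` hold the vertices, the members at proper pairs are the edges. -/
def SpatialGraph.ofFamily {n : ℕ} (S : Sym2 (Fin n) → Set Space) : SpatialGraph where
  vertices := ⋃ k, S s(k, k)
  edges := range fun e : Edge n => S e.1

theorem SpatialGraph.map_ofFamily {n : ℕ} (S : Sym2 (Fin n) → Set Space) (g : Space → Space) :
    (SpatialGraph.ofFamily S).map g = SpatialGraph.ofFamily fun e => g '' S e := by
  simp only [SpatialGraph.map, SpatialGraph.ofFamily, image_iUnion, ← range_comp]
  rfl

theorem FamilyIsotopic.ambientIsotopic {n : ℕ} {S S' : Sym2 (Fin n) → Set Space}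
    (h : FamilyIsotopic S S') :
    AmbientIsotopic (SpatialGraph.ofFamily S) (SpatialGraph.ofFamily S') := by
  obtain ⟨H, hH, h⟩ := h
  rw [ambientIsotopic_iff]
  exact ⟨H, hH, by simp only [SpatialGraph.map_ofFamily, h]⟩

/-- Relabelling the vertices does not change the spatial graph. -/
theorem SpatialGraph.ofFamily_relabel {n : ℕ} (S : Sym2 (Fin n) → Set Space)
    (π : Equiv.Perm (Fin n)) :
    SpatialGraph.ofFamily (fun e => S (e.map π)) = SpatialGraph.ofFamily S := by
  simp only [SpatialGraph.ofFamily, Sym2.map_mk, SpatialGraph.mk.injEq]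
  refine ⟨π.surjective.iUnion_comp fun k => S s(k, k), ?_⟩
  ext T
  simp only [mem_range, Subtype.exists, SimpleGraph.edgeSet_top]
  constructor
  · rintro ⟨e, he, rfl⟩
    refine ⟨e.map π, ?_, rfl⟩
    induction e with | _ a b => simpa using he
  · rintro ⟨e, he, rfl⟩
    refine ⟨e.map π.symm, ?_, ?_⟩
    · induction e with | _ a b => simpa using he
    · rw [Sym2.map_map]; simp

/-! ### Vertical isotopies -/

/-- A continuous map of space that preserves every vertical line, and restricts to an increasing
bijection of it, is a homeomorphism. -/
theorem exists_homeomorph_of_fiberwise {φ : ℂ → ℝ → ℝ}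
    (hφ : Continuous fun p : Space => φ p.1 p.2) (hmono : ∀ z, StrictMono (φ z))
    (hsurj : ∀ z, Function.Surjective (φ z)) :
    ∃ h : Space ≃ₜ Space, ∀ x, h x = (x.1, φ x.1 x.2) := by
  choose ψ hψ using hsurj
  have hψ' : ∀ z t, ψ z (φ z t) = t := fun z t => (hmono z).injective (hψ z _)
  have hcont : Continuous fun p : Space => ψ p.1 p.2 := by
    rw [continuous_iff_continuousAt]
    rintro ⟨z, u⟩
    have hat : ∀ t, Tendsto (fun p : Space => φ p.1 t) (𝓝 (z, u)) (𝓝 (φ z t)) := fun t =>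
      (hφ.comp (continuous_fst.prodMk continuous_const)).tendsto (z, u)
    have hsnd : Tendsto (fun p : Space => p.2) (𝓝 (z, u)) (𝓝 u) := continuous_snd.tendsto (z, u)
    refine tendsto_order.2 ⟨fun a ha => ?_, fun b hb => ?_⟩
    · have h1 : φ z a < u := by simpa only [hψ] using hmono z ha
      filter_upwards [(hat a).eventually_lt hsnd h1] with p hp
      exact (hmono p.1).lt_iff_lt.1 (by rwa [hψ])
    · have h1 : u < φ z b := by simpa only [hψ] using hmono z hb
      filter_upwards [hsnd.eventually_lt (hat b) h1] with p hp
      exact (hmono p.1).lt_iff_lt.1 (by rwa [hψ])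
  exact ⟨{ toFun := fun x => (x.1, φ x.1 x.2)
           invFun := fun x => (x.1, ψ x.1 x.2)
           left_inv := fun x => by simp [hψ']
           right_inv := fun x => by simp [hψ]
           continuous_toFun := continuous_fst.prodMk hφ
           continuous_invFun := continuous_fst.prodMk hcont }, fun x => rfl⟩

theorem exists_vertical_isotopy {φ : ℝ → ℂ → ℝ → ℝ}
    (hφ : Continuous fun p : ℝ × Space => φ p.1 p.2.1 p.2.2) (h0 : ∀ z t, φ 0 z t = t)
    (hmono : ∀ s ∈ Icc (0 : ℝ) 1, ∀ z, StrictMono (φ s z))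
    (hsurj : ∀ s ∈ Icc (0 : ℝ) 1, ∀ z, Function.Surjective (φ s z)) :
    ∃ H, IsAmbientIsotopy H ∧ ∀ x, H 1 x = (x.1, φ 1 x.1 x.2) := by
  have : ∀ s : unitInterval, ∃ h : Space ≃ₜ Space, ∀ x, h x = (x.1, φ s x.1 x.2) := fun s =>
    exists_homeomorph_of_fiberwise (hφ.comp (continuous_const.prodMk continuous_id))
      (hmono s s.2) (hsurj s s.2)
  choose H hH using this
  refine ⟨H, ⟨?_, ?_⟩, fun x => by simpa using hH 1 x⟩
  · simp only [hH]
    exact (continuous_fst.comp continuous_snd).prodMk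
      (hφ.comp ((continuous_subtype_val.comp continuous_fst).prodMk continuous_snd))
  · ext1 x
    simp [hH, h0]

/-- A bounded factor may be discontinuous where the other, continuous, factor vanishes. -/
theorem continuous_mul_of_bounded {X : Type*} [TopologicalSpace X] {f c : X → ℝ}
    (hf : Continuous f) (hc : ∀ x, |c x| ≤ 1) (hfc : ∀ x, f x ≠ 0 → ContinuousAt c x) :
    Continuous fun x => f x * c x := by
  rw [continuous_iff_continuousAt]
  intro x
  by_cases hx : f x = 0
  · rw [ContinuousAt, hx, zero_mul]
    refine squeeze_zero_norm (a := fun y => |f y|) (fun y => ?_) ?_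
    · rw [Real.norm_eq_abs, abs_mul]
      exact mul_le_of_le_one_right (abs_nonneg _) (hc y)
    · simpa [hx] using (hf.abs.tendsto x)
  · exact hf.continuousAt.mul (hfc x hx)

/-- The trapezoidal weight by which a raise from `G` to `G + δ` with clearance `r` moves the point
at height `t`: it is `1` at `G` and `0` outside the interval from `G - r` to `G + δ + r`. -/
noncomputable def raiseWeight (G δ r t : ℝ) : ℝ :=
  max 0 (min ((t - G + r) / r) ((G + δ + r - t) / (δ + r)))

theorem raiseWeight_nonneg (G δ r t : ℝ) : 0 ≤ raiseWeight G δ r t := le_max_left _ _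

theorem raiseWeight_le_one {G δ r : ℝ} (hr : 0 ≤ r) (hδ : 0 ≤ δ) (t : ℝ) :
    raiseWeight G δ r t ≤ 1 := by
  refine max_le zero_le_one ?_
  rcases le_total t G with h | h
  · exact (min_le_left _ _).trans (div_le_one_of_le₀ (by linarith) hr)
  · exact (min_le_right _ _).trans (div_le_one_of_le₀ (by linarith) (by linarith))

theorem raiseWeight_self {G δ r : ℝ} (hr : 0 < r) (hδ : 0 ≤ δ) : raiseWeight G δ r G = 1 := by
  have h1 : (G - G + r) / r = 1 := by field_simp; ring
  have h2 : (G + δ + r - G) / (δ + r) = 1 := by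
    rw [div_eq_one_iff_eq (by positivity)]; ring
  rw [raiseWeight, h1, h2, min_self, max_eq_right zero_le_one]

theorem raiseWeight_of_le {G δ r t : ℝ} (hr : 0 ≤ r) (h : t ≤ G - r) :
    raiseWeight G δ r t = 0 := by
  refine max_eq_left ((min_le_left _ _).trans ?_)
  exact div_nonpos_of_nonpos_of_nonneg (by linarith) hr

theorem raiseWeight_of_ge {G δ r t : ℝ} (hr : 0 ≤ r) (hδ : 0 ≤ δ) (h : G + δ + r ≤ t) :
    raiseWeight G δ r t = 0 := by
  refine max_eq_left ((min_le_right _ _).trans ?_)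
  exact div_nonpos_of_nonpos_of_nonneg (by linarith) (by linarith)

/-- The weight decreases with slope at most `1 / (δ + r)`, so that a displacement by less than
`δ + r` times the weight keeps the order on a vertical line. -/
theorem raiseWeight_sub_le {G δ r t t' : ℝ} (hr : 0 < r) (hδ : 0 ≤ δ) (h : t ≤ t') :
    raiseWeight G δ r t - (t' - t) / (δ + r) ≤ raiseWeight G δ r t' := by
  have h0 : 0 ≤ (t' - t) / (δ + r) := div_nonneg (by linarith) (by linarith)
  rw [sub_le_iff_le_add]
  refine max_le (add_nonneg (raiseWeight_nonneg _ _ _ _) h0) ?_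
  rw [← sub_le_iff_le_add]
  refine le_max_of_le_right (le_min ?_ ?_)
  · have : (t - G + r) / r ≤ (t' - G + r) / r := by gcongr
    linarith [min_le_left ((t - G + r) / r) ((G + δ + r - t) / (δ + r))]
  · have : (G + δ + r - t') / (δ + r) = (G + δ + r - t) / (δ + r) - (t' - t) / (δ + r) := by
      rw [← sub_div]; congr 1; ring
    linarith [min_le_right ((t - G + r) / r) ((G + δ + r - t) / (δ + r))]

/-- **Raising a piece of a surface through free space.** If the vertical segments between the
graphs of `g` and `g'` over `A` avoid `K`, except where they are degenerate, then the graph of `g`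
can be moved vertically to the graph of `g'` while `K` stays fixed. -/
theorem exists_isotopy_raise {A : Set ℂ} {g g' : ℂ → ℝ} {K : Set Space} (hA : IsClosed A)
    (hA0 : A.Nonempty) (hg : ContinuousOn g A) (hg' : ContinuousOn g' A)
    (hle : ∀ z ∈ A, g z ≤ g' z) (hK : IsClosed K) (hK0 : K.Nonempty)
    (hfree : ∀ z ∈ A, ∀ t ∈ Icc (g z) (g' z), (z, t) ∈ K → g z = g' z) :
    ∃ H, IsAmbientIsotopy H ∧ (∀ x ∈ K, H 1 x = x) ∧ ∀ z ∈ A, H 1 (z, g z) = (z, g' z) := by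
  obtain ⟨G, hG⟩ := ContinuousMap.exists_restrict_eq hA ⟨A.domRestrict g, hg.domRestrict⟩
  obtain ⟨E, hE⟩ := ContinuousMap.exists_restrict_eq hA
    ⟨A.domRestrict (fun z => g' z - g z), (hg'.sub hg).domRestrict⟩
  replace hG : ∀ z ∈ A, G z = g z := fun z hz => DFunLike.congr_fun hG ⟨z, hz⟩
  replace hE : ∀ z ∈ A, E z = g' z - g z := fun z hz => DFunLike.congr_fun hE ⟨z, hz⟩
  set δ : ℂ → ℝ := fun z => max 0 (E z) with hδdef
  have hδc : Continuous δ := continuous_const.max E.continuous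
  have hδ0 : ∀ z, 0 ≤ δ z := fun z => le_max_left _ _
  have hδA : ∀ z ∈ A, δ z = g' z - g z := fun z hz => by
    simp only [hδdef, hE z hz]; exact max_eq_right (sub_nonneg.2 (hle z hz))
  -- `r z` is the distance from the swept segment over `z` to `K`
  let F : ℂ → ℝ → ℝ := fun z τ => Metric.infDist ((z, G z + τ * δ z) : Space) K
  have hF : Continuous (Function.uncurry F) := by
    refine (Metric.continuous_infDist_pt K).comp (continuous_fst.prodMk ?_)
    exact (G.continuous.comp continuous_fst).add
      (continuous_snd.mul (hδc.comp continuous_fst))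
  set r : ℂ → ℝ := fun z => sInf (F z '' Icc 0 1) with hrdef
  have hrc : Continuous r := isCompact_Icc.continuous_sInf hF
  have hne : (Icc (0 : ℝ) 1).Nonempty := nonempty_Icc.2 zero_le_one
  have hrmin : ∀ z, ∃ τ ∈ Icc (0 : ℝ) 1, r z = F z τ ∧ ∀ τ' ∈ Icc (0 : ℝ) 1, F z τ ≤ F z τ' :=
    fun z => isCompact_Icc.exists_sInf_image_eq_and_le hne
      (hF.comp (continuous_const.prodMk continuous_id)).continuousOn
  have hrle : ∀ z, ∀ τ ∈ Icc (0 : ℝ) 1, r z ≤ F z τ := fun z τ hτ => by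
    obtain ⟨τ', -, h1, h2⟩ := hrmin z
    exact h1.trans_le (h2 τ hτ)
  have hr0 : ∀ z, 0 ≤ r z := fun z => by
    obtain ⟨τ', -, h1, -⟩ := hrmin z
    rw [h1]; exact Metric.infDist_nonneg
  have hrA : ∀ z ∈ A, r z = 0 → δ z = 0 := fun z hz h => by
    obtain ⟨τ, hτ, h1, -⟩ := hrmin z
    have hmem : ((z, G z + τ * δ z) : Space) ∈ K :=
      (hK.mem_iff_infDist_zero hK0).2 (h1.symm.trans h)
    have h2 := hδ0 z
    have := hfree z hz _ ⟨?_, ?_⟩ hmem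
    · rw [hδA z hz, this, sub_self]
    · rw [hG z hz]; nlinarith [hτ.1]
    · rw [hG z hz]; nlinarith [hτ.2, hδA z hz]
  -- away from `A` the displacement is damped so that it vanishes together with `r`
  set η : ℂ → ℝ := fun z => δ z * (r z / (r z + Metric.infDist z A)) with hηdef
  have hfrac : ∀ z, 0 ≤ r z / (r z + Metric.infDist z A) ∧
      r z / (r z + Metric.infDist z A) ≤ 1 := fun z =>
    ⟨div_nonneg (hr0 z) (add_nonneg (hr0 z) Metric.infDist_nonneg),
      div_le_one_of_le₀ (le_add_of_nonneg_right Metric.infDist_nonneg)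
        (add_nonneg (hr0 z) Metric.infDist_nonneg)⟩
  have hηc : Continuous η := by
    refine continuous_mul_of_bounded hδc (fun z => ?_) fun z hz => ?_
    · rw [abs_of_nonneg (hfrac z).1]; exact (hfrac z).2
    · refine hrc.continuousAt.div
        (hrc.add (Metric.continuous_infDist_pt A)).continuousAt fun h => hz ?_
      have h1 := hr0 z
      have h2 : 0 ≤ Metric.infDist z A := Metric.infDist_nonneg
      exact hrA z ((hA.mem_iff_infDist_zero hA0).2 (by linarith)) (by linarith)
  have hη0 : ∀ z, 0 ≤ η z := fun z => mul_nonneg (hδ0 z) (hfrac z).1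
  have hηδ : ∀ z, η z ≤ δ z := fun z => mul_le_of_le_one_right (hδ0 z) (hfrac z).2
  have hηr : ∀ z, r z = 0 → η z = 0 := fun z h => by simp [hηdef, h]
  have hηA : ∀ z ∈ A, η z = δ z := fun z hz => by
    by_cases h : r z = 0
    · rw [hηr z h, hrA z hz h]
    · simp only [hηdef, Metric.infDist_zero_of_mem hz, add_zero, div_self h, mul_one]
  -- the displacement at time `1`
  set D : Space → ℝ := fun p => η p.1 * raiseWeight (G p.1) (δ p.1) (r p.1) p.2 with hDdef
  have hDc : Continuous D := by
    refine continuous_mul_of_bounded (hηc.comp continuous_fst) (fun p => ?_) fun p hp => ?_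
    · rw [abs_of_nonneg (raiseWeight_nonneg _ _ _ _)]
      exact raiseWeight_le_one (hr0 _) (hδ0 _) _
    · have hr : r p.1 ≠ 0 := fun h => hp (hηr _ h)
      have hδr : δ p.1 + r p.1 ≠ 0 := fun h => hr (by linarith [hδ0 p.1, hr0 p.1])
      have c1 : Continuous fun p : Space => G p.1 := G.continuous.comp continuous_fst
      have c2 : Continuous fun p : Space => δ p.1 := hδc.comp continuous_fst
      have c3 : Continuous fun p : Space => r p.1 := hrc.comp continuous_fst
      have c4 : Continuous fun p : Space => p.2 := continuous_snd
      exact continuousAt_const.max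
        ((((c4.sub c1).add c3).continuousAt.div c3.continuousAt hr).min
          ((((c1.add c2).add c3).sub c4).continuousAt.div (c2.add c3).continuousAt hδr))
  have hD0 : ∀ p, 0 ≤ D p := fun p => mul_nonneg (hη0 _) (raiseWeight_nonneg _ _ _ _)
  have hDη : ∀ p, D p ≤ η p.1 := fun p =>
    mul_le_of_le_one_right (hη0 _) (raiseWeight_le_one (hr0 _) (hδ0 _) _)
  obtain ⟨H, hH, hH1⟩ := exists_vertical_isotopy (φ := fun s z t => t + s * D (z, t))
    (by
      have : Continuous fun p : ℝ × Space => D p.2 := hDc.comp continuous_snd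
      exact (continuous_snd.comp continuous_snd).add (continuous_fst.mul this))
    (fun z t => by simp)
    (by
      intro s hs z t t' htt
      simp only [hDdef]
      rcases (hr0 z).eq_or_lt with h | h
      · simpa [hηr z h.symm] using htt
      · have h1 := raiseWeight_sub_le (G := G z) h (hδ0 z) htt.le
        set a := raiseWeight (G z) (δ z) (r z) t
        set b := raiseWeight (G z) (δ z) (r z) t'
        have hpos : 0 < δ z + r z := by linarith [hδ0 z]
        have hsη : s * η z ≤ δ z := by nlinarith [hs.1, hs.2, hη0 z, hηδ z]
        have hsη0 : 0 ≤ s * η z := mul_nonneg hs.1 (hη0 z)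
        have h2 : s * η z * ((t' - t) / (δ z + r z)) < t' - t := by
          rw [mul_div_assoc', div_lt_iff₀ hpos]
          nlinarith
        have h3 : s * η z * (a - b) ≤ s * η z * ((t' - t) / (δ z + r z)) :=
          mul_le_mul_of_nonneg_left (by linarith) hsη0
        nlinarith)
    (by
      intro s hs z
      have hc : Continuous fun t : ℝ => t + s * D (z, t) :=
        continuous_id.add (continuous_const.mul (hDc.comp (continuous_const.prodMk continuous_id)))
      refine hc.surjective ?_ ?_
      · exact tendsto_atTop_mono (fun t => le_add_of_nonneg_right (mul_nonneg hs.1 (hD0 _)))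
          tendsto_id
      · refine tendsto_atBot_mono (fun t => ?_) (tendsto_atBot_add_const_right _ (η z) tendsto_id)
        have := hDη (z, t)
        have := hD0 (z, t)
        simp only [id]
        nlinarith [hs.1, hs.2])
  refine ⟨H, hH, ?_, ?_⟩
  · rintro ⟨z, t⟩ hzt
    have : D (z, t) = 0 := by
      simp only [hDdef]
      have hdist : ∀ τ, Metric.infDist ((z, G z + τ * δ z) : Space) K ≤ |G z + τ * δ z - t| :=
        fun τ => (Metric.infDist_le_dist_of_mem hzt).trans (by
          simp [Prod.dist_eq, Real.dist_eq])
      rcases le_total t (G z) with h | h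
      · have h1 := (hrle z 0 ⟨le_rfl, zero_le_one⟩).trans (hdist 0)
        rw [zero_mul, add_zero, abs_of_nonneg (by linarith)] at h1
        rw [raiseWeight_of_le (hr0 z) (by linarith), mul_zero]
      rcases le_total (G z + δ z) t with h' | h'
      · have h1 := (hrle z 1 ⟨zero_le_one, le_rfl⟩).trans (hdist 1)
        rw [one_mul, abs_of_nonpos (by linarith)] at h1
        rw [raiseWeight_of_ge (hr0 z) (hδ0 z) (by linarith), mul_zero]
      · have h1 : r z = 0 := by
          refine le_antisymm ?_ (hr0 z)
          rcases (hδ0 z).eq_or_lt with h0 | h0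
          · refine ((hrle z 0 ⟨le_rfl, zero_le_one⟩).trans (hdist 0)).trans (le_of_eq ?_)
            rw [show t = G z by linarith]; simp
          · have hτ : (t - G z) / δ z ∈ Icc (0 : ℝ) 1 :=
              ⟨div_nonneg (by linarith) h0.le, div_le_one_of_le₀ (by linarith) h0.le⟩
            refine ((hrle z _ hτ).trans (hdist _)).trans (le_of_eq ?_)
            rw [div_mul_cancel₀ _ h0.ne']; simp
        rw [hηr z h1, zero_mul]
    rw [hH1]
    simp [this]
  · intro z hz
    rw [hH1]
    simp only [hDdef, one_mul]
    rw [← hG z hz]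
    congr 1
    rcases (hr0 z).eq_or_lt with h | h
    · have := hδA z hz
      rw [hηr z h.symm]
      rw [hrA z hz h.symm] at this
      rw [hG z hz]; linarith
    · rw [raiseWeight_self h (hδ0 z), hηA z hz, hδA z hz, hG z hz]; ring

/-! ### Families of arcs over plane sets -/

/-- The part over `A` of the graph of the height function `g`. -/
def arc (A : Set ℂ) (g : ℂ → ℝ) : Set Space := (fun p => (p, g p)) '' A

theorem isClosed_arc {A : Set ℂ} {g : ℂ → ℝ} (hA : IsCompact A) (hg : ContinuousOn g A) :
    IsClosed (arc A g) :=
  (hA.image_of_continuousOn (continuousOn_id.prodMk hg)).isClosed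

/-- The two families of heights agree about the relative position of the arcs with indices `i` and
`j` at a common point `p` of their projections: either both arcs pass through the same point,
which does not move, or the arc of higher rank lies above the other one. -/
def Compatible {ι : Type*} (r : ι → ℕ) (h h' : ι → ℂ → ℝ) (i j : ι) (p : ℂ) : Prop :=
  (h i p = h j p ∧ h' i p = h i p ∧ h' j p = h j p) ∨
    (r i < r j ∧ h i p < h j p ∧ h' i p < h' j p) ∨
    (r j < r i ∧ h j p < h i p ∧ h' j p < h' i p)

section
variable {ι : Type*} [Finite ι] [Nontrivial ι] {A : ι → Set ℂ} {r : ι → ℕ} {h h' : ι → ℂ → ℝ}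

/-- The arcs are raised one at a time, beginning with those of highest rank. -/
theorem familyIsotopic_sup (hA : ∀ i, IsCompact (A i)) (hA0 : ∀ i, (A i).Nonempty)
    (hh : ∀ i, ContinuousOn (h i) (A i)) (hh' : ∀ i, ContinuousOn (h' i) (A i))
    (hr : ∀ i j, i ≠ j → ∀ p ∈ A i, p ∈ A j → Compatible r h h' i j p) :
    FamilyIsotopic (fun i => arc (A i) (h i)) (fun i => arc (A i) (h i ⊔ h' i)) := by
  classical
  have := Fintype.ofFinite ι
  -- the heights once the arcs with index in `s` have been raised
  let q : Finset ι → ι → ℂ → ℝ := fun s i => if i ∈ s then h i ⊔ h' i else h i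
  have hq : ∀ s i, ContinuousOn (q s i) (A i) := fun s i => by
    by_cases hi : i ∈ s
    · simp only [q, if_pos hi]
      exact (hh i).sup (hh' i)
    · simpa only [q, if_neg hi] using hh i
  suffices H : ∀ s : Finset ι, (∀ i ∈ s, ∀ j, r i < r j → j ∈ s) →
      FamilyIsotopic (fun i => arc (A i) (h i)) (fun i => arc (A i) (q s i)) by
    simpa [q] using H Finset.univ fun _ _ _ _ => Finset.mem_univ _
  intro s
  induction s using Finset.induction_on_min_value r with
  | empty => intro _; simpa [q] using FamilyIsotopic.refl _
  | insert a s has hmin ih =>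
    intro hs
    have hup : ∀ j, r a < r j → j ∈ s := fun j hj =>
      (Finset.mem_insert.1 (hs a (Finset.mem_insert_self _ _) j hj)).resolve_left
        fun e => (e ▸ hj).ne rfl
    refine (ih fun i hi j hij => hup j ((hmin i hi).trans_lt hij)).trans ?_
    obtain ⟨b, hb⟩ := exists_ne a
    obtain ⟨H, hH, hfix, hmove⟩ := exists_isotopy_raise (A := A a) (g := h a) (g' := h a ⊔ h' a)
      (K := ⋃ j ∈ {j | j ≠ a}, arc (A j) (q s j)) (hA a).isClosed (hA0 a) (hh a)
      ((hh a).sup (hh' a)) (fun z _ => le_sup_left)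
      ((Set.toFinite _).isClosed_biUnion fun j _ => isClosed_arc (hA j) (hq s j))
      (by
        obtain ⟨z, hz⟩ := hA0 b
        exact ⟨_, mem_biUnion (show b ∈ {j | j ≠ a} from hb) ⟨z, hz, rfl⟩⟩)
      (by
        intro z hz t ht hK
        simp only [mem_iUnion] at hK
        obtain ⟨j, hj, p, hp, hpz⟩ := hK
        obtain ⟨rfl, rfl⟩ := Prod.ext_iff.1 hpz
        simp only [mem_Icc, Pi.sup_apply, le_sup_iff] at ht ⊢
        simp only at hz
        rcases hr a j (Ne.symm hj) p hz hp with ⟨h1, h2, h3⟩ | ⟨h1, h2, h3⟩ | ⟨h1, h2, h3⟩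
        · rw [h2, sup_idem]
        · have hjs := hup j h1
          simp only [q, if_pos hjs, Pi.sup_apply] at ht
          rcases ht.2 with h4 | h4
          · exact absurd (h2.trans_le (le_sup_left.trans h4)) (lt_irrefl _)
          · exact absurd (h3.trans_le (le_sup_right.trans h4)) (lt_irrefl _)
        · have hjs : j ∉ s := fun hjs => absurd (hmin j hjs) (not_le.2 h1)
          simp only [q, if_neg hjs] at ht
          exact absurd (ht.1.trans_lt h2) (lt_irrefl _))
    refine ⟨H, hH, fun i => ?_⟩
    by_cases hi : i = a
    · subst hi
      simp only [q, if_neg has, if_pos (Finset.mem_insert_self _ _), arc, image_image]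
      exact image_congr hmove
    · have e : q (insert a s) i = q s i := by simp [q, hi]
      simp only [e]
      refine (image_congr fun x hx => hfix x ?_).trans (image_id' _)
      exact mem_biUnion (show i ∈ {j | j ≠ a} from hi) hx

/-- **Spatial graphs over the same plane drawing.** If two families of arcs have the same
projections, and at each point where two projections meet either the arcs meet at an unmoved point
or their order is that of a fixed ranking, then they are isotopic. -/
theorem familyIsotopic_of_compatible (hA : ∀ i, IsCompact (A i)) (hA0 : ∀ i, (A i).Nonempty)
    (hh : ∀ i, ContinuousOn (h i) (A i)) (hh' : ∀ i, ContinuousOn (h' i) (A i))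
    (hr : ∀ i j, i ≠ j → ∀ p ∈ A i, p ∈ A j → Compatible r h h' i j p) :
    FamilyIsotopic (fun i => arc (A i) (h i)) (fun i => arc (A i) (h' i)) := by
  refine (familyIsotopic_sup hA hA0 hh hh' hr).trans (FamilyIsotopic.symm ?_)
  have e : (fun i => arc (A i) (h i ⊔ h' i)) = fun i => arc (A i) (h' i ⊔ h i) := by
    funext i; rw [sup_comm]
  rw [e]
  refine familyIsotopic_sup (r := r) hA hA0 hh' hh fun i j hij p hi hj => ?_
  rcases hr i j hij p hi hj with ⟨h1, h2, h3⟩ | ⟨h1, h2, h3⟩ | ⟨h1, h2, h3⟩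
  · exact Or.inl ⟨by rw [h2, h3, h1], h2.symm, h3.symm⟩
  · exact Or.inr (Or.inl ⟨h1, h3, h2⟩)
  · exact Or.inr (Or.inr ⟨h1, h3, h2⟩)

end

/-! ### The geometry of the hexagon -/

/-- First coordinate with respect to the real basis of `ℂ` formed by the vertices `0` and `1` of
the hexagon; in this basis all vertices have integer coordinates. -/
noncomputable def hexX (z : ℂ) : ℝ := z.re + z.im / √3

/-- Second coordinate with respect to the vertices `0` and `1` of the hexagon. -/
noncomputable def hexY (z : ℂ) : ℝ := -(2 * z.im / √3)

/-- The first coordinates of the vertices. -/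
def vx : Fin 6 → ℤ := ![1, 0, -1, -1, 0, 1]

/-- The second coordinates of the vertices. -/
def vy : Fin 6 → ℤ := ![0, 1, 1, 0, -1, -1]

theorem continuous_hexX : Continuous hexX := by unfold hexX; fun_prop

theorem continuous_hexY : Continuous hexY := by unfold hexY; fun_prop

theorem hex_ext {z w : ℂ} (hx : hexX z = hexX w) (hy : hexY z = hexY w) : z = w := by
  have h3 : √3 ≠ 0 := by positivity
  simp only [hexX, hexY] at hx hy
  field_simp at hx hy
  apply Complex.ext <;> nlinarith [hx, hy, Real.sqrt_pos.2 (show (0 : ℝ) < 3 by norm_num),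
    mul_left_cancel₀ h3 (show √3 * z.re = √3 * w.re by linarith)]

theorem hexX_add (z w : ℂ) : hexX (z + w) = hexX z + hexX w := by
  simp only [hexX, Complex.add_re, Complex.add_im]; ring

theorem hexY_add (z w : ℂ) : hexY (z + w) = hexY z + hexY w := by
  simp only [hexY, Complex.add_im]; ring

theorem hexX_smul (c : ℝ) (z : ℂ) : hexX (c • z) = c * hexX z := by
  simp only [hexX, Complex.real_smul, Complex.re_ofReal_mul, Complex.im_ofReal_mul]; ring

theorem hexY_smul (c : ℝ) (z : ℂ) : hexY (c • z) = c * hexY z := by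
  simp only [hexY, Complex.real_smul, Complex.im_ofReal_mul]; ring

theorem norm_sq_eq_hex (z : ℂ) : ‖z‖ ^ 2 = hexX z ^ 2 + hexX z * hexY z + hexY z ^ 2 := by
  have h3 : √3 ^ 2 = 3 := Real.sq_sqrt (by norm_num)
  have h : √3 ≠ 0 := by positivity
  rw [Complex.sq_norm, Complex.normSq_apply, hexX, hexY]
  field_simp
  linear_combination z.im ^ 2 * h3

theorem vertexPos_eq (k : Fin 6) :
    vertexPos k = ⟨Real.cos (k * (Real.pi / 3)), -Real.sin (k * (Real.pi / 3))⟩ := by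
  have : -(2 * Real.pi * ((k : ℕ) : ℂ) / (6 : ℕ)) * Complex.I
      = ((-(k * (Real.pi / 3)) : ℝ) : ℂ) * Complex.I := by push_cast; ring
  rw [vertexPos, this]
  apply Complex.ext
  · rw [Complex.exp_ofReal_mul_I_re, Real.cos_neg]
  · rw [Complex.exp_ofReal_mul_I_im, Real.sin_neg]

theorem hex_vertexPos (k : Fin 6) : hexX (vertexPos k) = vx k ∧ hexY (vertexPos k) = vy k := by
  have h : √3 ≠ 0 := by positivity
  have e2 : 2 * (Real.pi / 3) = Real.pi - Real.pi / 3 := by ring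
  have e3 : 3 * (Real.pi / 3) = Real.pi := by ring
  have e4 : 4 * (Real.pi / 3) = Real.pi / 3 + Real.pi := by ring
  have e5 : 5 * (Real.pi / 3) = -(Real.pi / 3) + 2 * Real.pi := by ring
  rw [vertexPos_eq, hexX, hexY]
  fin_cases k <;>
    simp [e2, e3, e4, e5, vx, vy, Real.cos_pi_sub, Real.sin_pi_sub, Real.cos_add_pi,
      Real.sin_add_pi] <;> field_simp <;> norm_num

theorem hexX_vertexPos (k : Fin 6) : hexX (vertexPos k) = vx k := (hex_vertexPos k).1

theorem hexY_vertexPos (k : Fin 6) : hexY (vertexPos k) = vy k := (hex_vertexPos k).2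

/-! ### Chords of the hexagon -/

/-- The point of the chord from `a` to `b` that divides it in the ratio `s : 1 - s`. -/
noncomputable def chordPoint (a b : Fin 6) (s : ℝ) : ℂ :=
  (1 - s) • vertexPos a + s • vertexPos b

theorem chord_mk (a b : Fin 6) : chord s(a, b) = chordPoint a b '' Icc 0 1 := by
  exact segment_eq_image ℝ (vertexPos a) (vertexPos b)

theorem hexX_chordPoint (a b : Fin 6) (s : ℝ) :
    hexX (chordPoint a b s) = (1 - s) * vx a + s * vx b := by
  rw [chordPoint, hexX_add, hexX_smul, hexX_smul, hexX_vertexPos, hexX_vertexPos]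

theorem hexY_chordPoint (a b : Fin 6) (s : ℝ) :
    hexY (chordPoint a b s) = (1 - s) * vy a + s * vy b := by
  rw [chordPoint, hexY_add, hexY_smul, hexY_smul, hexY_vertexPos, hexY_vertexPos]

theorem chordPoint_zero (a b : Fin 6) : chordPoint a b 0 = vertexPos a := by simp [chordPoint]

theorem chordPoint_one (a b : Fin 6) : chordPoint a b 1 = vertexPos b := by simp [chordPoint]

theorem chordPoint_self (a : Fin 6) (s : ℝ) : chordPoint a a s = vertexPos a := by
  rw [chordPoint, ← add_smul, sub_add_cancel, one_smul]

theorem vertexPos_injective : Function.Injective (vertexPos : Fin 6 → ℂ) := by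
  intro a b h
  have hx := congrArg hexX h
  have hy := congrArg hexY h
  rw [hexX_vertexPos, hexX_vertexPos, Int.cast_inj] at hx
  rw [hexY_vertexPos, hexY_vertexPos, Int.cast_inj] at hy
  have key : ∀ a b : Fin 6, vx a = vx b → vy a = vy b → a = b := by decide
  exact key a b hx hy

theorem vertexPos_mem_chord {k : Fin 6} {e : Sym2 (Fin 6)} (h : k ∈ e) :
    vertexPos k ∈ chord e := by
  induction e with | _ a b =>
  rw [chord_mk]
  rcases Sym2.mem_iff.1 h with rfl | rfl
  · exact ⟨0, ⟨le_rfl, zero_le_one⟩, chordPoint_zero _ _⟩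
  · exact ⟨1, ⟨zero_le_one, le_rfl⟩, chordPoint_one _ _⟩

theorem chord_nonempty (e : Sym2 (Fin 6)) : (chord e).Nonempty := by
  induction e with | _ a b => exact ⟨_, vertexPos_mem_chord (Sym2.mem_mk_left a b)⟩

theorem isCompact_chord (e : Sym2 (Fin 6)) : IsCompact (chord e) := by
  induction e with | _ a b =>
  rw [chord_mk]
  refine isCompact_Icc.image ?_
  unfold chordPoint
  fun_prop

theorem norm_chordPoint_sq (a b : Fin 6) (s : ℝ) : ‖chordPoint a b s‖ ^ 2 = 1 - s * (1 - s) *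
    (((vx a - vx b) ^ 2 + (vx a - vx b) * (vy a - vy b) + (vy a - vy b) ^ 2 : ℤ) : ℝ) := by
  have key : ∀ k : Fin 6, vx k ^ 2 + vx k * vy k + vy k ^ 2 = 1 := by decide
  have ha : (vx a ^ 2 + vx a * vy a + vy a ^ 2 : ℝ) = 1 := mod_cast key a
  have hb : (vx b ^ 2 + vx b * vy b + vy b ^ 2 : ℝ) = 1 := mod_cast key b
  rw [norm_sq_eq_hex, hexX_chordPoint, hexY_chordPoint]
  push_cast
  linear_combination (1 - s) * ha + s * hb

theorem norm_vertexPos (k : Fin 6) : ‖vertexPos k‖ = 1 := by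
  have h := norm_chordPoint_sq k k 0
  rw [chordPoint_zero] at h
  have h0 := norm_nonneg (vertexPos k)
  nlinarith

theorem norm_chordPoint_le (a b : Fin 6) {s : ℝ} (hs : s ∈ Icc (0 : ℝ) 1) :
    ‖chordPoint a b s‖ ≤ 1 := by
  have key : ∀ a b : Fin 6,
      0 ≤ (vx a - vx b) ^ 2 + (vx a - vx b) * (vy a - vy b) + (vy a - vy b) ^ 2 := by decide
  have h : (0 : ℝ) ≤
      (((vx a - vx b) ^ 2 + (vx a - vx b) * (vy a - vy b) + (vy a - vy b) ^ 2 : ℤ) : ℝ) :=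
    mod_cast key a b
  have h1 := norm_chordPoint_sq a b s
  have h2 := mul_nonneg (mul_nonneg hs.1 (sub_nonneg.2 hs.2)) h
  nlinarith [norm_nonneg (chordPoint a b s)]

theorem norm_chordPoint_lt {a b : Fin 6} (hab : a ≠ b) {s : ℝ} (h0 : 0 < s) (h1 : s < 1) :
    ‖chordPoint a b s‖ < 1 := by
  have key : ∀ a b : Fin 6, a ≠ b →
      0 < (vx a - vx b) ^ 2 + (vx a - vx b) * (vy a - vy b) + (vy a - vy b) ^ 2 := by decide
  have h : (0 : ℝ) <
      (((vx a - vx b) ^ 2 + (vx a - vx b) * (vy a - vy b) + (vy a - vy b) ^ 2 : ℤ) : ℝ) :=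
    mod_cast key a b hab
  have h2 := norm_chordPoint_sq a b s
  have h3 := mul_pos (mul_pos h0 (sub_pos.2 h1)) h
  nlinarith [norm_nonneg (chordPoint a b s)]

theorem chord_subset_closedBall (e : Sym2 (Fin 6)) : chord e ⊆ Metric.closedBall 0 1 := by
  induction e with | _ a b =>
  rw [chord_mk]
  rintro _ ⟨s, hs, rfl⟩
  simpa using norm_chordPoint_le a b hs

/-- A point of a chord is an end of it, or lies in the interior of the disk. -/
theorem vertex_or_norm_lt {e : Sym2 (Fin 6)} {p : ℂ} (hp : p ∈ chord e) :
    (∃ k ∈ e, p = vertexPos k) ∨ ‖p‖ < 1 := by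
  induction e with | _ a b =>
  rw [chord_mk] at hp
  obtain ⟨s, hs, rfl⟩ := hp
  by_cases hab : a = b
  · exact Or.inl ⟨a, Sym2.mem_mk_left _ _, by rw [← hab, chordPoint_self]⟩
  rcases hs.1.eq_or_lt with h | h
  · exact Or.inl ⟨a, Sym2.mem_mk_left _ _, by rw [← h, chordPoint_zero]⟩
  rcases hs.2.eq_or_lt with h' | h'
  · exact Or.inl ⟨b, Sym2.mem_mk_right _ _, by rw [h', chordPoint_one]⟩
  · exact Or.inr (norm_chordPoint_lt hab h h')

theorem mem_of_vertexPos_mem_chord {k : Fin 6} {e : Sym2 (Fin 6)} (h : vertexPos k ∈ chord e) :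
    k ∈ e := by
  rcases vertex_or_norm_lt h with ⟨k', hk', h'⟩ | h'
  · rwa [vertexPos_injective h']
  · exact absurd (norm_vertexPos k) h'.ne

/-- The orientation of the triangle with vertices `a`, `b`, `k`, up to a constant factor. -/
def orient (a b k : Fin 6) : ℤ :=
  (vx b - vx a) * (vy k - vy a) - (vy b - vy a) * (vx k - vx a)

/-- Two chords cross when the ends of the second lie strictly on different sides of the first. -/
def Separates (a b c d : Fin 6) : Prop := orient a b c * orient a b d < 0

instance (a b c d : Fin 6) : Decidable (Separates a b c d) :=
  inferInstanceAs (Decidable (_ < _))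

/-- Two unordered pairs of labels are the ends of crossing chords. -/
def Cross (e f : Sym2 (Fin 6)) : Prop := ∃ a b c d, e = s(a, b) ∧ f = s(c, d) ∧ Separates a b c d

/-- Distinct chords meet only in common ends, unless they cross. -/
theorem common_vertex_or_cross {e f : Sym2 (Fin 6)} (hef : e ≠ f) {p : ℂ} (he : p ∈ chord e)
    (hf : p ∈ chord f) : (∃ k ∈ e, k ∈ f ∧ p = vertexPos k) ∨ (Cross e f ∧ ‖p‖ < 1) := by
  rcases vertex_or_norm_lt he with ⟨k, hk, rfl⟩ | hp
  · exact Or.inl ⟨k, hk, mem_of_vertexPos_mem_chord hf, rfl⟩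
  refine Or.inr ⟨?_, hp⟩
  rcases vertex_or_norm_lt hf with ⟨k, hk, rfl⟩ | -
  · exact absurd (norm_vertexPos k) hp.ne
  induction e with | _ a b =>
  induction f with | _ c d =>
  refine ⟨a, b, c, d, rfl, rfl, ?_⟩
  have hpv : ∀ k, p ≠ vertexPos k := fun k h => absurd (norm_vertexPos k) (h ▸ hp.ne)
  rw [chord_mk] at he hf
  obtain ⟨s, hs, rfl⟩ := he
  obtain ⟨t, ht, htp⟩ := hf
  have hab : a ≠ b := fun h => hpv a (by rw [← h, chordPoint_self])
  have hcd : c ≠ d := fun h => hpv c (by rw [← htp, ← h, chordPoint_self])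
  have ht0 : 0 < t := ht.1.lt_of_ne fun h => hpv c (by rw [← htp, ← h, chordPoint_zero])
  have ht1 : t < 1 := ht.2.lt_of_ne fun h => hpv d (by rw [← htp, h, chordPoint_one])
  have hx := congrArg hexX htp
  have hy := congrArg hexY htp
  rw [hexX_chordPoint, hexX_chordPoint] at hx
  rw [hexY_chordPoint, hexY_chordPoint] at hy
  have hzero : (1 - t) * (orient a b c : ℝ) + t * (orient a b d : ℝ) = 0 := by
    simp only [orient]
    push_cast
    linear_combination (vx b - vx a : ℝ) * hy - (vy b - vy a : ℝ) * hx
  have key : ∀ a b k : Fin 6, a ≠ b → orient a b k = 0 → k = a ∨ k = b := by decide +kernel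
  have hc : orient a b c ≠ 0 := fun h => by
    have h' : orient a b d = 0 := by
      rw [h, Int.cast_zero, mul_zero, zero_add] at hzero
      exact_mod_cast (mul_eq_zero.1 hzero).resolve_left ht0.ne'
    rcases key a b c hab h with rfl | rfl <;> rcases key _ _ d hab h' with rfl | rfl <;>
      simp_all [Sym2.eq_swap]
  have hcr : (orient a b c : ℝ) ≠ 0 := mod_cast hc
  have : (orient a b c : ℝ) * orient a b d < 0 := by
    have : t * ((orient a b c : ℝ) * orient a b d) = -((1 - t) * (orient a b c : ℝ) ^ 2) := by
      linear_combination (orient a b c : ℝ) * hzero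
    have h2 : 0 < (1 - t) * (orient a b c : ℝ) ^ 2 := by
      have := sub_pos.2 ht1
      positivity
    by_contra hcon
    have := mul_nonneg ht0.le (not_lt.1 hcon)
    linarith
  exact_mod_cast this

set_option synthInstance.maxSize 1000 in
set_option synthInstance.maxHeartbeats 400000 in
/-- Crossing edges of `K_6`, in the sense of alternating ends. -/
theorem Cross.crosses {e f : Edge 6} (h : Cross e.1 f.1) : Crosses e f := by
  obtain ⟨a, b, c, d, he, hf, h⟩ := h
  have key : ∀ a b c d : Fin 6, Separates a b c d →
      (a < c ∧ c < b ∧ b < d) ∨ (b < c ∧ c < a ∧ a < d) ∨ (a < d ∧ d < b ∧ b < c) ∨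
      (b < d ∧ d < a ∧ a < c) ∨ (c < a ∧ a < d ∧ d < b) ∨ (d < a ∧ a < c ∧ c < b) ∨
      (c < b ∧ b < d ∧ d < a) ∨ (d < b ∧ b < c ∧ c < a) := by decide +kernel
  have sw : ∀ x y : Fin 6, s(x, y) = s(y, x) := fun _ _ => Sym2.eq_swap
  rcases key a b c d h with h | h | h | h | h | h | h | h
  · exact ⟨a, c, b, d, h.1, h.2.1, h.2.2, Or.inl ⟨he, hf⟩⟩
  · exact ⟨b, c, a, d, h.1, h.2.1, h.2.2, Or.inl ⟨he.trans (sw _ _), hf⟩⟩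
  · exact ⟨a, d, b, c, h.1, h.2.1, h.2.2, Or.inl ⟨he, hf.trans (sw _ _)⟩⟩
  · exact ⟨b, d, a, c, h.1, h.2.1, h.2.2, Or.inl ⟨he.trans (sw _ _), hf.trans (sw _ _)⟩⟩
  · exact ⟨c, a, d, b, h.1, h.2.1, h.2.2, Or.inr ⟨he, hf⟩⟩
  · exact ⟨d, a, c, b, h.1, h.2.1, h.2.2, Or.inr ⟨he, hf.trans (sw _ _)⟩⟩
  · exact ⟨c, b, d, a, h.1, h.2.1, h.2.2, Or.inr ⟨he.trans (sw _ _), hf⟩⟩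
  · exact ⟨d, b, c, a, h.1, h.2.1, h.2.2, Or.inr ⟨he.trans (sw _ _), hf.trans (sw _ _)⟩⟩

/-! ### Height functions over the chords -/

theorem Cross.symm {e f : Sym2 (Fin 6)} (h : Cross e f) : Cross f e := by
  obtain ⟨a, b, c, d, he, hf, h⟩ := h
  have key : ∀ a b c d : Fin 6, Separates a b c d → Separates c d a b := by decide +kernel
  exact ⟨c, d, a, b, hf, he, key a b c d h⟩

theorem Compatible.of_vertex {ι : Type*} {r : ι → ℕ} {h h' : ι → ℂ → ℝ} {i j : ι} {p : ℂ}
    (hi : h i p = 0) (hj : h j p = 0) (hi' : h' i p = 0) (hj' : h' j p = 0) :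
    Compatible r h h' i j p :=
  Or.inl ⟨hi.trans hj.symm, hi'.trans hi.symm, hj'.trans hj.symm⟩

/-- The height functions `h e`, for `e` in `E`, vanish at the vertices, and where two chords cross
they are ordered according to the ranking `r`. -/
structure RankedHeights (E : Set (Sym2 (Fin 6))) (r : Sym2 (Fin 6) → ℕ)
    (h : Sym2 (Fin 6) → ℂ → ℝ) : Prop where
  continuousOn : ∀ e ∈ E, ContinuousOn (h e) (chord e)
  vertex : ∀ e ∈ E, ∀ k ∈ e, h e (vertexPos k) = 0
  lt : ∀ e ∈ E, ∀ f ∈ E, Cross e f → r e < r f →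
    ∀ p ∈ chord e, p ∈ chord f → ‖p‖ < 1 → h e p < h f p

section
variable {E : Set (Sym2 (Fin 6))} {r : Sym2 (Fin 6) → ℕ} {h h' : Sym2 (Fin 6) → ℂ → ℝ}

theorem RankedHeights.compatible (hh : RankedHeights E r h) (hh' : RankedHeights E r h')
    {e f : Sym2 (Fin 6)} (heE : e ∈ E) (hfE : f ∈ E) (hr : Cross e f → r e ≠ r f) (hef : e ≠ f)
    {p : ℂ} (he : p ∈ chord e) (hf : p ∈ chord f) : Compatible r h h' e f p := by
  rcases common_vertex_or_cross hef he hf with ⟨k, hke, hkf, rfl⟩ | ⟨hc, hp⟩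
  · exact .of_vertex (hh.vertex e heE k hke) (hh.vertex f hfE k hkf) (hh'.vertex e heE k hke)
      (hh'.vertex f hfE k hkf)
  · rcases (hr hc).lt_or_gt with hlt | hlt
    · exact Or.inr (Or.inl ⟨hlt, hh.lt e heE f hfE hc hlt p he hf hp,
        hh'.lt e heE f hfE hc hlt p he hf hp⟩)
    · exact Or.inr (Or.inr ⟨hlt, hh.lt f hfE e heE hc.symm hlt p hf he hp,
        hh'.lt f hfE e heE hc.symm hlt p hf he hp⟩)

instance : Nontrivial (Sym2 (Fin 6)) := ⟨s(0, 0), s(0, 1), by decide⟩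

/-- Systems of heights with the same ranking are isotopic. -/
theorem RankedHeights.familyIsotopic (hh : RankedHeights univ r h)
    (hh' : RankedHeights univ r h') (hr : ∀ e f, Cross e f → r e ≠ r f) :
    FamilyIsotopic (fun e => arc (chord e) (h e)) (fun e => arc (chord e) (h' e)) :=
  familyIsotopic_of_compatible isCompact_chord chord_nonempty
    (fun e => hh.continuousOn e (mem_univ e)) (fun e => hh'.continuousOn e (mem_univ e))
    fun e f hef _ he hf => hh.compatible hh' (mem_univ e) (mem_univ f) (hr e f) hef he hf

end

/-! ### Sheets -/

/-- The arcs over all chords, when the chord `e` lies in sheet `c e` of a stack. Over the diagonal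
these are the vertices, for any value of `c`. -/
def sheetFamily (c : Sym2 (Fin 6) → Fin 3) (F : SheetStack 3) : Sym2 (Fin 6) → Set Space :=
  fun e => arc (chord e) (F.height (c e))

theorem SheetStack.height_vertexPos {s : ℕ} (F : SheetStack s) (i : Fin s) (k : Fin 6) :
    F.height i (vertexPos k) = 0 :=
  F.height_boundary i _ (by simp [norm_vertexPos])

theorem spatialGraph_eq_ofFamily (B : BookRepresentation 6 3) (F : SheetStack 3)
    {c : Sym2 (Fin 6) → Fin 3} (hc : ∀ e : Edge 6, B.sheet e = c e.1) :
    B.spatialGraph F = SpatialGraph.ofFamily (sheetFamily c F) := by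
  simp only [BookRepresentation.spatialGraph, SpatialGraph.ofFamily, SpatialGraph.mk.injEq]
  refine ⟨?_, by simp only [hc]; rfl⟩
  ext x
  have hk : ∀ k : Fin 6, chord s(k, k) = {vertexPos k} := fun k => by
    rw [chord_mk]
    ext z
    simp only [chordPoint_self, mem_image, mem_singleton_iff]
    exact ⟨fun ⟨_, _, h⟩ => h.symm, fun h => ⟨0, by simp, h.symm⟩⟩
  simp only [mem_range, mem_iUnion, sheetFamily, arc, hk, image_singleton,
    F.height_vertexPos, mem_singleton_iff, eq_comm]

theorem rankedHeights_sheet (c : Sym2 (Fin 6) → Fin 3) (F : SheetStack 3) {r : Sym2 (Fin 6) → ℕ}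
    (hr : ∀ e f, Cross e f → r e < r f → c f < c e) :
    RankedHeights univ r fun e => F.height (c e) where
  continuousOn e _ := (F.continuousOn_height _).mono (chord_subset_closedBall e)
  vertex e _ k _ := F.height_vertexPos _ k
  lt e _ f _ hc hlt p _ _ hp := F.height_lt _ _ (hr e f hc hlt) p (by simpa using hp)

/-- The assignment `c` of chords to sheets separates crossing chords. -/
def Admissible (c : Sym2 (Fin 6) → Fin 3) : Prop := ∀ e f, Cross e f → c e ≠ c f

/-- Neither the stack of disks nor the sheets of the exterior edges matter. -/
theorem sheetFamily_isotopic {c c' : Sym2 (Fin 6) → Fin 3} (hc : Admissible c)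
    (hcc : ∀ e f, Cross e f → c e = c' e) (F F' : SheetStack 3) :
    FamilyIsotopic (sheetFamily c F) (sheetFamily c' F') := by
  refine (rankedHeights_sheet c F (r := fun e => 2 - c e) fun e f h hlt => ?_).familyIsotopic
    (rankedHeights_sheet c' F' fun e f h hlt => ?_) fun e f h heq => hc e f h (Fin.ext ?_)
  · rw [Fin.lt_def]; omega
  · rw [← hcc e f h, ← hcc f e h.symm, Fin.lt_def]; omega
  · have heq' : 2 - (c e : ℕ) = 2 - c f := heq
    omega

/-- The assignment of the canonical representation. -/
def canonicalSheet (e : Sym2 (Fin 6)) : Fin 3 :=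
  if e = s(1, 5) ∨ e = s(2, 4) ∨ e = s(2, 5) then 1
  else if e = s(2, 6) ∨ e = s(3, 5) ∨ e = s(3, 6) then 2
  else 0

theorem canonicalSheet_admissible : Admissible canonicalSheet := by
  rintro _ _ ⟨a, b, c, d, rfl, rfl, h⟩
  have key : ∀ a b c d : Fin 6, Separates a b c d →
      canonicalSheet s(a, b) ≠ canonicalSheet s(c, d) := by decide +kernel
  exact key a b c d h

theorem canonicalK6_spatialGraph (F : SheetStack 3) :
    canonicalK6.spatialGraph F = SpatialGraph.ofFamily (sheetFamily canonicalSheet F) :=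
  spatialGraph_eq_ofFamily _ _ fun _ => rfl

/-! ### Symmetries -/

/-- The stack composed with an isometry of the plane. -/
noncomputable def SheetStack.comp {s : ℕ} (F : SheetStack s) (g : ℂ ≃ₗᵢ[ℝ] ℂ) : SheetStack s where
  height i z := F.height i (g z)
  continuousOn_height i := (F.continuousOn_height i).comp g.continuous.continuousOn
    fun z hz => by simpa using hz
  height_boundary i p hp := F.height_boundary i _ (by simpa using hp)
  height_lt i j hij p hp := F.height_lt i j hij _ (by simpa using hp)

/-- The stack turned upside down. -/
noncomputable def SheetStack.flip {s : ℕ} (F : SheetStack s) : SheetStack s where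
  height i z := -F.height i.rev z
  continuousOn_height i := (F.continuousOn_height i.rev).neg
  height_boundary i p hp := by simp [F.height_boundary i.rev p hp]
  height_lt i j hij p hp := neg_lt_neg (F.height_lt _ _ (Fin.rev_lt_rev.2 hij) p hp)

theorem image_chord (g : ℂ ≃ₗᵢ[ℝ] ℂ) {π : Fin 6 → Fin 6}
    (hg : ∀ k, g (vertexPos k) = vertexPos (π k)) (e : Sym2 (Fin 6)) :
    g '' chord e = chord (e.map π) := by
  induction e with | _ a b =>
  rw [Sym2.map_mk, chord_mk, chord_mk, image_image]
  refine image_congr fun s _ => ?_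
  simp only [chordPoint, map_add, map_smul, hg]

theorem image_sheetFamily_comp (g : ℂ ≃ₗᵢ[ℝ] ℂ) {π : Fin 6 → Fin 6}
    (hg : ∀ k, g (vertexPos k) = vertexPos (π k)) (c : Sym2 (Fin 6) → Fin 3) (F : SheetStack 3)
    (e : Sym2 (Fin 6)) :
    (fun x : Space => ((g x.1, x.2) : Space)) '' sheetFamily (fun e => c (e.map π)) F e
      = sheetFamily c (F.comp g.symm) (e.map π) := by
  simp only [sheetFamily, arc, ← image_chord g hg, image_image, SheetStack.comp,
    LinearIsometryEquiv.symm_apply_apply]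

theorem image_sheetFamily_flip (c : Sym2 (Fin 6) → Fin 3) (F : SheetStack 3)
    (e : Sym2 (Fin 6)) :
    (fun x : Space => ((x.1, -x.2) : Space)) '' sheetFamily (fun e => (c e).rev) F e
      = sheetFamily c F.flip e := by
  simp only [sheetFamily, arc, image_image, SheetStack.flip]

/-- The clockwise rotation of the plane by `t` steps of the hexagon. -/
noncomputable def hexRotation (t : ℝ) : ℂ ≃ₗᵢ[ℝ] ℂ := rotation (Circle.exp (-(t * (Real.pi / 3))))

theorem hexRotation_apply (t : ℝ) (z : ℂ) :
    hexRotation t z = Complex.exp (-(t * (Real.pi / 3)) * Complex.I) * z := by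
  rw [hexRotation, rotation_apply, Circle.coe_exp]
  push_cast
  rfl

theorem hexRotation_vertexPos (k : Fin 6) : hexRotation 1 (vertexPos k) = vertexPos (k + 1) := by
  have e : Complex.exp (-(((1 : ℝ) : ℂ) * (Real.pi / 3)) * Complex.I) = ⟨1 / 2, -(√3 / 2)⟩ := by
    have : (-(((1 : ℝ) : ℂ) * (Real.pi / 3)) * Complex.I)
        = ((-(Real.pi / 3) : ℝ) : ℂ) * Complex.I := by push_cast; ring
    rw [this]
    apply Complex.ext
    · rw [Complex.exp_ofReal_mul_I_re, Real.cos_neg, Real.cos_pi_div_three]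
    · rw [Complex.exp_ofReal_mul_I_im, Real.sin_neg, Real.sin_pi_div_three]
  have h3 : √3 ^ 2 = 3 := Real.sq_sqrt (by norm_num)
  have h : √3 ≠ 0 := by positivity
  have hX : ∀ z, hexX (hexRotation 1 z) = -hexY z := fun z => by
    simp only [hexRotation_apply, e, hexX, hexY, Complex.mul_re, Complex.mul_im]
    field_simp
    linear_combination z.im * h3
  have hY : ∀ z, hexY (hexRotation 1 z) = hexX z + hexY z := fun z => by
    simp only [hexRotation_apply, e, hexX, hexY, Complex.mul_im]
    field_simp
    ring
  have key : ∀ k : Fin 6, vx (k + 1) = -vy k ∧ vy (k + 1) = vx k + vy k := by decide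
  apply hex_ext
  · rw [hX, hexX_vertexPos, hexY_vertexPos, (key k).1]; push_cast; ring
  · rw [hY, hexX_vertexPos, hexY_vertexPos, hexY_vertexPos, (key k).2]; push_cast; ring

theorem isAmbientIsotopy_rotation : IsAmbientIsotopy fun t =>
    (hexRotation t).toHomeomorph.prodCongr (Homeomorph.refl ℝ) := by
  refine ⟨?_, ?_⟩
  · simp only [Homeomorph.coe_prodCongr, Prod.map, LinearIsometryEquiv.coe_toHomeomorph,
      hexRotation_apply, Homeomorph.refl_apply]
    fun_prop
  · ext1 x
    simp [Prod.map, hexRotation_apply]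

/-- Rotation of space about the real axis of the horizontal plane by the angle `θ`. -/
noncomputable def turn (θ : ℝ) : Space ≃ₜ Space where
  toFun x := (⟨x.1.re, Real.cos θ * x.1.im - Real.sin θ * x.2⟩,
    Real.sin θ * x.1.im + Real.cos θ * x.2)
  invFun x := (⟨x.1.re, Real.cos θ * x.1.im + Real.sin θ * x.2⟩,
    -Real.sin θ * x.1.im + Real.cos θ * x.2)
  left_inv x := by
    have := Real.sin_sq_add_cos_sq θ
    refine Prod.ext (Complex.ext rfl ?_) ?_
    · simp only; linear_combination x.1.im * this
    · simp only; linear_combination x.2 * this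
  right_inv x := by
    have := Real.sin_sq_add_cos_sq θ
    refine Prod.ext (Complex.ext rfl ?_) ?_
    · simp only; linear_combination x.1.im * this
    · simp only; linear_combination x.2 * this
  continuous_toFun := by
    refine Continuous.prodMk ?_ (by fun_prop)
    exact Complex.equivRealProdCLM.symm.continuous.comp
      (f := fun x : Space => (x.1.re, Real.cos θ * x.1.im - Real.sin θ * x.2)) (by fun_prop)
  continuous_invFun := by
    refine Continuous.prodMk ?_ (by fun_prop)
    exact Complex.equivRealProdCLM.symm.continuous.comp
      (f := fun x : Space => (x.1.re, Real.cos θ * x.1.im + Real.sin θ * x.2)) (by fun_prop)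

theorem isAmbientIsotopy_turn : IsAmbientIsotopy fun t => turn (Real.pi * t) := by
  refine ⟨?_, ?_⟩
  · refine Continuous.prodMk ?_ (by fun_prop)
    exact Complex.equivRealProdCLM.symm.continuous.comp
      (f := fun p : unitInterval × Space => (p.2.1.re,
        Real.cos (Real.pi * p.1) * p.2.1.im - Real.sin (Real.pi * p.1) * p.2.2)) (by fun_prop)
  · ext1 x
    simp [turn]

theorem turn_pi (x : Space) : turn Real.pi x = (Complex.conjLIE x.1, -x.2) := by
  refine Prod.ext (Complex.ext ?_ ?_) ?_ <;> simp [turn]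

theorem conj_vertexPos (k : Fin 6) : Complex.conjLIE (vertexPos k) = vertexPos (-k) := by
  have key : ∀ k : Fin 6, vx (-k) = vx k + vy k ∧ vy (-k) = -vy k := by decide
  have hX : ∀ z, hexX (Complex.conjLIE z) = hexX z + hexY z := fun z => by
    rw [Complex.conjLIE_apply, hexX, hexX, hexY, Complex.conj_re, Complex.conj_im]; ring
  have hY : ∀ z, hexY (Complex.conjLIE z) = -hexY z := fun z => by
    rw [Complex.conjLIE_apply, hexY, hexY, Complex.conj_im]; ring
  apply hex_ext
  · rw [hX, hexX_vertexPos, hexX_vertexPos, hexY_vertexPos, (key k).1]; push_cast; ring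
  · rw [hY, hexY_vertexPos, hexY_vertexPos, (key k).2]; push_cast; ring

/-! ### Classification of the assignments -/

/-- Every spatial graph with the assignment `c` of the chords to sheets is ambient isotopic to the
canonical ones. -/
def IsCanonical (c : Sym2 (Fin 6) → Fin 3) : Prop := ∀ F F' : SheetStack 3,
  AmbientIsotopic (SpatialGraph.ofFamily (sheetFamily c F))
    (SpatialGraph.ofFamily (sheetFamily canonicalSheet F'))

theorem isCanonical_canonicalSheet : IsCanonical canonicalSheet := fun F F' =>
  (sheetFamily_isotopic canonicalSheet_admissible (fun _ _ _ => rfl) F F').ambientIsotopic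

theorem IsCanonical.rotate {c : Sym2 (Fin 6) → Fin 3} (hc : IsCanonical c) :
    IsCanonical fun e => c (e.map (· + 1)) := by
  intro F F'
  have h : FamilyIsotopic (sheetFamily (fun e => c (e.map (· + 1))) F)
      fun e => sheetFamily c (F.comp (hexRotation 1).symm) (e.map (Equiv.addRight 1)) :=
    ⟨_, isAmbientIsotopy_rotation, fun e =>
      image_sheetFamily_comp (hexRotation 1) hexRotation_vertexPos c F e⟩
  refine h.ambientIsotopic.trans ?_
  rw [SpatialGraph.ofFamily_relabel]
  exact hc _ _

/-- The half-turn about the real axis reflects the hexagon and reverses the sheets. -/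
theorem IsCanonical.turn {c : Sym2 (Fin 6) → Fin 3} (hc : IsCanonical c) :
    IsCanonical fun e => (c (e.map (-·))).rev := by
  intro F F'
  have h : FamilyIsotopic (sheetFamily (fun e => (c (e.map (-·))).rev) F)
      fun e => sheetFamily c (F.flip.comp Complex.conjLIE.symm) (e.map (Equiv.neg (Fin 6))) := by
    refine ⟨_, isAmbientIsotopy_turn, fun e => ?_⟩
    have e1 : ∀ S : Set Space, BookRep.turn (Real.pi * ((1 : unitInterval) : ℝ)) '' S =
        (fun x : Space => ((Complex.conjLIE x.1, x.2) : Space)) ''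
          ((fun x : Space => ((x.1, -x.2) : Space)) '' S) := fun S => by
      rw [image_image]
      refine image_congr fun x _ => ?_
      rw [Set.Icc.coe_one, mul_one, turn_pi]
    rw [e1, image_sheetFamily_flip (fun e => c (e.map (-·)))]
    exact image_sheetFamily_comp Complex.conjLIE conj_vertexPos c _ e
  refine h.ambientIsotopic.trans ?_
  rw [SpatialGraph.ofFamily_relabel]
  exact hc _ _

theorem mirror_ofFamily_sheetFamily (c : Sym2 (Fin 6) → Fin 3) (F : SheetStack 3) :
    (SpatialGraph.ofFamily (sheetFamily (fun e => (c e).rev) F)).mirror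
      = SpatialGraph.ofFamily (sheetFamily c F.flip) := by
  rw [SpatialGraph.mirror, SpatialGraph.map_ofFamily]
  simp only [image_sheetFamily_flip]

/-- The canonical graphs are ambient isotopic to their mirror images. -/
def CanonicalAchiral : Prop := ∀ F : SheetStack 3,
  AmbientIsotopic (SpatialGraph.ofFamily (sheetFamily canonicalSheet F))
    (SpatialGraph.ofFamily (sheetFamily canonicalSheet F)).mirror

theorem IsCanonical.rev {c : Sym2 (Fin 6) → Fin 3} (hc : IsCanonical c)
    (ha : CanonicalAchiral) : IsCanonical fun e => (c e).rev := by
  intro F F'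
  have h := (hc F.flip F').mirror
  rw [← mirror_ofFamily_sheetFamily, SpatialGraph.mirror_mirror] at h
  exact h.trans (ha F').symm

/-- The canonical assignment transformed by a symmetry of the hexagon and, possibly, a reversal of
the sheets. -/
def transformedSheet (k : Fin 6) (reflect reverse : Bool) (e : Sym2 (Fin 6)) : Fin 3 :=
  let i := canonicalSheet (e.map fun a => (if reflect then -a else a) + k)
  if reverse then i.rev else i

theorem isCanonical_transformedSheet (ha : CanonicalAchiral) (k : Fin 6) (b b' : Bool) :
    IsCanonical (transformedSheet k b b') := by
  have step : ∀ k : Fin 6, IsCanonical (fun e => canonicalSheet (e.map (· + k))) →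
      IsCanonical fun e => canonicalSheet (e.map (· + (k + 1))) := fun k hk => by
    convert hk.rotate using 3 with e
    rw [Sym2.map_map]
    congr 1
    funext a
    simp only [Function.comp, add_assoc, add_comm 1 k]
  have p0 : IsCanonical fun e => canonicalSheet (e.map (· + 0)) := by
    simpa using isCanonical_canonicalSheet
  have p1 := step _ p0
  have p2 := step _ p1
  have p3 := step _ p2
  have p4 := step _ p3
  have p5 := step _ p4
  have h1 : IsCanonical fun e => canonicalSheet (e.map (· + k)) := by
    fin_cases k
    exacts [p0, p1, p2, p3, p4, p5]
  have h2 : IsCanonical (transformedSheet k b false) := by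
    cases b with
    | false => exact h1
    | true =>
      have := h1.turn.rev ha
      simp only [Fin.rev_rev, Sym2.map_map] at this
      exact this
  cases b' with
  | false => exact h2
  | true => exact h2.rev ha

set_option synthInstance.maxSize 2000 in
set_option synthInstance.maxHeartbeats 400000 in
/-- The twelve ways to distribute the interior edges among three sheets. -/
theorem exists_transformedSheet {c : Sym2 (Fin 6) → Fin 3} (hc : Admissible c) :
    ∃ k b b', ∀ e f, Cross e f → c e = transformedSheet k b b' e := by
  -- each constraint stands directly after the last variable it involves, to prune the search
  have key : ∀ x y : Fin 3, x ≠ y → ∀ z : Fin 3, x ≠ z → y ≠ z →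
      ∀ x₁ : Fin 3, x₁ ≠ y → ∀ x₂ : Fin 3, x₁ ≠ x₂ → x₂ ≠ z →
      ∀ x₃ : Fin 3, x₂ ≠ x₃ → x ≠ x₃ → ∀ x₄ : Fin 3, x₄ ≠ x₃ → x₄ ≠ y →
      ∀ x₅ : Fin 3, x₄ ≠ x₅ → x₅ ≠ z → ∀ x₆ : Fin 3, x₅ ≠ x₆ → x ≠ x₆ → x₁ ≠ x₆ →
      ∃ k b b', x = transformedSheet k b b' s(1, 4) ∧ y = transformedSheet k b b' s(2, 5) ∧
        z = transformedSheet k b b' s(3, 0) ∧ x₁ = transformedSheet k b b' s(1, 3) ∧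
        x₂ = transformedSheet k b b' s(2, 4) ∧ x₃ = transformedSheet k b b' s(3, 5) ∧
        x₄ = transformedSheet k b b' s(4, 0) ∧ x₅ = transformedSheet k b b' s(5, 1) ∧
        x₆ = transformedSheet k b b' s(0, 2) := by decide +kernel
  have interior : ∀ a b c d : Fin 6, Separates a b c d → s(a, b) = s(1, 4) ∨ s(a, b) = s(2, 5) ∨
      s(a, b) = s(3, 0) ∨ s(a, b) = s(1, 3) ∨ s(a, b) = s(2, 4) ∨ s(a, b) = s(3, 5) ∨
      s(a, b) = s(4, 0) ∨ s(a, b) = s(5, 1) ∨ s(a, b) = s(0, 2) := by decide +kernel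
  have ne : ∀ a b a' b', Separates a b a' b' → c s(a, b) ≠ c s(a', b') := fun a b a' b' h =>
    hc _ _ ⟨a, b, a', b', rfl, rfl, h⟩
  obtain ⟨k, b, b', h⟩ := key (c s(1, 4)) (c s(2, 5)) (ne _ _ _ _ (by decide)) (c s(3, 0))
    (ne _ _ _ _ (by decide)) (ne _ _ _ _ (by decide)) (c s(1, 3)) (ne _ _ _ _ (by decide))
    (c s(2, 4)) (ne _ _ _ _ (by decide)) (ne _ _ _ _ (by decide)) (c s(3, 5))
    (ne _ _ _ _ (by decide)) (ne _ _ _ _ (by decide)) (c s(4, 0)) (ne _ _ _ _ (by decide))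
    (ne _ _ _ _ (by decide)) (c s(5, 1)) (ne _ _ _ _ (by decide)) (ne _ _ _ _ (by decide))
    (c s(0, 2)) (ne _ _ _ _ (by decide)) (ne _ _ _ _ (by decide)) (ne _ _ _ _ (by decide))
  refine ⟨k, b, b', ?_⟩
  rintro _ _ ⟨p, q, p', q', rfl, rfl, hs⟩
  obtain ⟨h1, h2, h3, h4, h5, h6, h7, h8, h9⟩ := h
  rcases interior p q p' q' hs with h | h | h | h | h | h | h | h | h <;> rw [h] <;> assumption

theorem isCanonical_of_admissible (ha : CanonicalAchiral) {c : Sym2 (Fin 6) → Fin 3}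
    (hc : Admissible c) : IsCanonical c := by
  obtain ⟨k, b, b', h⟩ := exists_transformedSheet hc
  exact fun F F' => (sheetFamily_isotopic hc h F F').ambientIsotopic.trans
    (isCanonical_transformedSheet ha k b b' F' F')

theorem ambientIsotopic_canonicalK6 (ha : CanonicalAchiral) (B : BookRepresentation 6 3)
    (F F' : SheetStack 3) : AmbientIsotopic (B.spatialGraph F) (canonicalK6.spatialGraph F') := by
  classical
  let c : Sym2 (Fin 6) → Fin 3 := fun e =>
    if h : e ∈ (⊤ : SimpleGraph (Fin 6)).edgeSet then B.sheet ⟨e, h⟩ else 0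
  have hcB : ∀ e : Edge 6, B.sheet e = c e.1 := fun e => by
    simp only [c]; rw [dif_pos e.2]
  have hc : Admissible c := by
    have key : ∀ a b c d : Fin 6, Separates a b c d → a ≠ b := by decide +kernel
    have mem : ∀ e f, Cross e f → e ∈ (⊤ : SimpleGraph (Fin 6)).edgeSet := by
      rintro _ _ ⟨a, b, c, d, rfl, rfl, h⟩
      simpa using key a b c d h
    intro e f h
    have he := mem e f h
    have hf := mem f e h.symm
    rw [← hcB ⟨e, he⟩, ← hcB ⟨f, hf⟩]
    exact B.sheet_ne _ _ (Cross.crosses h)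
  rw [spatialGraph_eq_ofFamily B F hcB, canonicalK6_spatialGraph]
  exact isCanonical_of_admissible ha hc F F'

/-- The three long diagonals cross each other, so that they need three sheets. -/
theorem isLeast_sheets : IsLeast {s : ℕ | Nonempty (BookRepresentation 6 s)} 3 := by
  refine ⟨⟨canonicalK6⟩, ?_⟩
  rintro s ⟨B⟩
  have ne : ∀ (a b c d : Fin 6) (h : s(a, b) ∈ (⊤ : SimpleGraph (Fin 6)).edgeSet)
      (h' : s(c, d) ∈ (⊤ : SimpleGraph (Fin 6)).edgeSet), Separates a b c d →
      B.sheet ⟨_, h⟩ ≠ B.sheet ⟨_, h'⟩ := fun a b c d h h' hs =>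
    B.sheet_ne _ _ (Cross.crosses ⟨a, b, c, d, rfl, rfl, hs⟩)
  have h12 := ne 1 4 2 5 (by simp) (by simp) (by decide)
  have h13 := ne 1 4 3 0 (by simp) (by simp) (by decide)
  have h23 := ne 2 5 3 0 (by simp) (by simp) (by decide)
  rw [Ne, Fin.ext_iff] at h12 h13 h23
  have := (B.sheet ⟨s(1, 4), by simp⟩).2
  have := (B.sheet ⟨s(2, 5), by simp⟩).2
  have := (B.sheet ⟨s(3, 0), by simp⟩).2
  omega

/-! ### Shears -/

theorem exists_horizontal_shear {f : ℝ → ℂ} (hf : Continuous f) :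
    ∃ H, IsAmbientIsotopy H ∧ ∀ x, H 1 x = (x.1 + f x.2, x.2) := by
  refine ⟨fun s =>
    { toFun := fun x => (x.1 + (s : ℝ) • f x.2, x.2)
      invFun := fun x => (x.1 - (s : ℝ) • f x.2, x.2)
      left_inv := fun x => by simp
      right_inv := fun x => by simp
      continuous_toFun := by fun_prop
      continuous_invFun := by fun_prop }, ⟨?_, ?_⟩, fun x => ?_⟩
  · change Continuous fun p : unitInterval × Space => (p.2.1 + (p.1 : ℝ) • f p.2.2, p.2.2)
    fun_prop
  · ext1 x
    simp
  · simp

theorem exists_vertical_shear {f : ℂ → ℝ} (hf : Continuous f) :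
    ∃ H, IsAmbientIsotopy H ∧ ∀ x, H 1 x = (x.1, x.2 + f x.1) := by
  obtain ⟨H, hH, h⟩ := exists_vertical_isotopy (φ := fun s z t => t + s * f z) (by fun_prop)
    (by simp) (fun _ _ _ _ _ h => by simpa using h)
    (fun s _ z u => ⟨u - s * f z, by simp⟩)
  exact ⟨H, hH, fun x => by simpa using h x⟩

/-! ### The edge 13 moves out of the hexagon -/

/-- On the chord from `1` to `3` this is the tent function with slopes `1` and `-1`. -/
noncomputable def tent (z : ℂ) : ℝ := min (-hexX z) (hexY z)

theorem continuous_tent : Continuous tent := continuous_hexX.neg.min continuous_hexY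

theorem tent_chordPoint (s : ℝ) : tent (chordPoint 1 3 s) = min s (1 - s) := by
  rw [tent, hexX_chordPoint, hexY_chordPoint]
  simp [vx, vy]

/-- The sheet heights `-(1 - ‖z‖ ^ 2)`, `-2 * (1 - ‖z‖ ^ 2)`, `-3 * (1 - ‖z‖ ^ 2)` for all edges
except `13`. -/
noncomputable def bowl (e : Sym2 (Fin 6)) (z : ℂ) : ℝ :=
  -(((canonicalSheet e : ℕ) : ℝ) + 1) * (1 - ‖z‖ ^ 2)

theorem continuous_bowl (e : Sym2 (Fin 6)) : Continuous (bowl e) := by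
  unfold bowl
  fun_prop

theorem bowl_vertexPos (e : Sym2 (Fin 6)) (k : Fin 6) : bowl e (vertexPos k) = 0 := by
  simp [bowl, norm_vertexPos]

theorem bowl_nonpos (e : Sym2 (Fin 6)) {z : ℂ} (hz : ‖z‖ ≤ 1) : bowl e z ≤ 0 := by
  have : ‖z‖ ^ 2 ≤ 1 := pow_le_one₀ (norm_nonneg _) hz
  rw [bowl, neg_mul, neg_nonpos]
  exact mul_nonneg (by positivity) (by linarith)

theorem bowl_lt {e f : Sym2 (Fin 6)} (h : canonicalSheet f < canonicalSheet e) {z : ℂ}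
    (hz : ‖z‖ < 1) : bowl e z < bowl f z := by
  have h1 : ‖z‖ ^ 2 < 1 := pow_lt_one₀ (norm_nonneg _) hz two_ne_zero
  have h2 : ((canonicalSheet f : ℕ) : ℝ) < (canonicalSheet e : ℕ) := by exact_mod_cast h
  simp only [bowl]
  nlinarith

/-- The canonical sheets, with the edge `13` raised above the plane and the others below it. -/
noncomputable def raisedHeight (e : Sym2 (Fin 6)) : ℂ → ℝ := if e = s(1, 3) then tent else bowl e

theorem tent_nonneg {z : ℂ} (hz : z ∈ chord (n := 6) s(1, 3)) : 0 ≤ tent z := by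
  rw [chord_mk] at hz
  obtain ⟨s, hs, rfl⟩ := hz
  rw [tent_chordPoint]
  exact le_min hs.1 (sub_nonneg.2 hs.2)

/-- `13` lies in the top sheet, so that raising it changes no crossing. -/
theorem rankedHeights_raisedHeight :
    RankedHeights univ (fun e => 2 - canonicalSheet e) raisedHeight where
  continuousOn e _ := by
    unfold raisedHeight
    split_ifs
    · exact continuous_tent.continuousOn
    · exact (continuous_bowl e).continuousOn
  vertex e _ k hk := by
    unfold raisedHeight
    split_ifs with h
    · subst h
      rcases Sym2.mem_iff.1 hk with rfl | rfl
      · rw [← chordPoint_zero 1 3, tent_chordPoint]; simp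
      · rw [← chordPoint_one 1 3, tent_chordPoint]; simp
    · exact bowl_vertexPos e k
  lt e _ f _ _ hlt p he hf hp := by
    have hlt' : canonicalSheet f < canonicalSheet e := by rw [Fin.lt_def]; omega
    have he13 : e ≠ s(1, 3) := by
      rintro rfl
      exact absurd hlt' (Fin.not_lt_zero _)
    simp only [raisedHeight, if_neg he13]
    split_ifs with h
    · subst h
      refine lt_of_lt_of_le ?_ (tent_nonneg hf)
      have : ‖p‖ ^ 2 < 1 := pow_lt_one₀ (norm_nonneg _) hp two_ne_zero
      rw [bowl, neg_mul, neg_lt_zero]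
      exact mul_pos (by positivity) (by linarith)
    · exact bowl_lt hlt' hp

/-- The path from `1` to `3` around the vertex `2` formed by two tangents of the circle. -/
noncomputable def outerPath : Set ℂ :=
  (fun z => z + (3 * tent z) • vertexPos (2 : Fin 6)) '' chord (n := 6) s(1, 3)

theorem isCompact_outerPath : IsCompact outerPath :=
  (isCompact_chord _).image (by have := continuous_tent; fun_prop)

theorem exists_of_mem_outerPath {z : ℂ} (hz : z ∈ outerPath) : ∃ s ∈ Icc (0 : ℝ) 1,
    z = chordPoint 1 3 s + (3 * min s (1 - s)) • vertexPos (2 : Fin 6) ∧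
    hexX z = -s - 3 * min s (1 - s) ∧ hexY z = 1 - s + 3 * min s (1 - s) := by
  obtain ⟨w, hw, rfl⟩ := hz
  rw [chord_mk] at hw
  obtain ⟨s, hs, rfl⟩ := hw
  refine ⟨s, hs, by simp only [tent_chordPoint], ?_, ?_⟩
  · simp only [tent_chordPoint, hexX_add, hexX_smul, hexX_chordPoint, hexX_vertexPos]
    simp [vx]; ring
  · simp only [tent_chordPoint, hexY_add, hexY_smul, hexY_chordPoint, hexY_vertexPos]
    simp [vy]

/-- The outer path leaves the closed disk immediately. -/
theorem vertex_of_mem_outerPath {z : ℂ} (hz : z ∈ outerPath) (h1 : ‖z‖ ≤ 1) :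
    z = vertexPos (1 : Fin 6) ∨ z = vertexPos (3 : Fin 6) := by
  obtain ⟨s, hs, rfl, hX, hY⟩ := exists_of_mem_outerPath hz
  have hn := norm_sq_eq_hex (chordPoint 1 3 s + (3 * min s (1 - s)) • vertexPos (2 : Fin 6))
  have hn1 : ‖chordPoint 1 3 s + (3 * min s (1 - s)) • vertexPos (2 : Fin 6)‖ ^ 2 ≤ 1 :=
    pow_le_one₀ (norm_nonneg _) h1
  rw [hn, hX, hY] at hn1
  have hs0 := hs.1
  have hs1 := hs.2
  rcases min_cases s (1 - s) with ⟨h, h'⟩ | ⟨h, h'⟩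
  · left
    rw [h] at hn1
    have : s = 0 := by nlinarith
    subst this
    simp [chordPoint_zero]
  · right
    rw [h] at hn1
    have : s = 1 := by nlinarith
    subst this
    simp [chordPoint_one]

/-- The plane drawing in which the chord from `1` to `3` is replaced by the outer path. -/
noncomputable def drawing (e : Sym2 (Fin 6)) : Set ℂ := if e = s(1, 3) then outerPath else chord e

/-- Heights after `13` has been sheared outwards; on the outer path the height is recovered from
the distance to the chord. -/
noncomputable def shearedHeight (e : Sym2 (Fin 6)) : ℂ → ℝ :=
  if e = s(1, 3) then fun z => (hexY z - hexX z - 1) / 6 else bowl e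

/-- The shear moves points horizontally in proportion to their height above the plane, so that only
`13` moves. -/
theorem raised_isotopic_sheared : FamilyIsotopic (fun e => arc (chord e) (raisedHeight e))
    (fun e => arc (drawing e) (shearedHeight e)) := by
  obtain ⟨H, hH, h⟩ := exists_horizontal_shear (f := fun t => (3 * max t 0) • vertexPos (2 : Fin 6))
    (by fun_prop)
  refine ⟨H, hH, fun e => ?_⟩
  by_cases he : e = s(1, 3)
  · subst he
    simp only [raisedHeight, shearedHeight, drawing, if_true, arc, outerPath, image_image]
    refine image_congr fun z hz => ?_
    rw [h]
    simp only [max_eq_left (tent_nonneg hz)]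
    congr 1
    rw [chord_mk] at hz
    obtain ⟨s, hs, rfl⟩ := hz
    simp only [tent_chordPoint, hexX_add, hexX_smul, hexX_chordPoint, hexX_vertexPos, hexY_add,
      hexY_smul, hexY_chordPoint, hexY_vertexPos]
    simp [vx, vy]; ring
  · simp only [raisedHeight, shearedHeight, drawing, if_neg he, arc, image_image]
    refine image_congr fun z hz => ?_
    rw [h]
    have hz1 : ‖z‖ ≤ 1 := by simpa using chord_subset_closedBall e hz
    simp [max_eq_right (bowl_nonpos e hz1)]

/-! ### Straightening the remaining edges -/

/-- Positive beyond the chord `35`, where it raises the vertex `4` to height `1`, and negative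
beyond the chord `15`, where it lowers the vertex `6` to height `-1`. -/
noncomputable def lift (z : ℂ) : ℝ :=
  max 0 (-hexX z - 2 * hexY z - 1) - max 0 (2 * hexX z + hexY z - 1)

theorem continuous_lift : Continuous lift := by
  have := continuous_hexX
  have := continuous_hexY
  unfold lift
  fun_prop

/-- The final heights of the vertices. -/
def vz : Fin 6 → ℤ := ![-1, 0, 0, 0, 1, 0]

theorem lift_vertexPos (k : Fin 6) : lift (vertexPos k) = vz k := by
  rw [lift, hexX_vertexPos, hexY_vertexPos]
  fin_cases k <;> norm_num [vx, vy, vz]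

/-- The affine function of a point of the plane that on the chord from `a` to `b` interpolates
between the final heights of its ends. -/
noncomputable def interpolate (a b : Fin 6) (z : ℂ) : ℝ :=
  vz a + (vz b - vz a) *
    (inner ℝ (z - vertexPos a) (vertexPos b - vertexPos a) / ‖vertexPos b - vertexPos a‖ ^ 2)

theorem interpolate_chordPoint (a b : Fin 6) (s : ℝ) :
    interpolate a b (chordPoint a b s) = (1 - s) * vz a + s * vz b := by
  have h : chordPoint a b s - vertexPos a = s • (vertexPos b - vertexPos a) := by
    rw [chordPoint]; module
  by_cases hab : a = b
  · subst hab; simp only [interpolate, sub_self, zero_mul, add_zero]; ring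
  · have : vertexPos b - vertexPos a ≠ 0 :=
      sub_ne_zero.2 fun h => hab (vertexPos_injective h).symm
    rw [interpolate, h, real_inner_smul_left, real_inner_self_eq_norm_sq,
      mul_div_cancel_right₀ _ (by positivity)]
    ring

theorem interpolate_comm (a b : Fin 6) : interpolate a b = interpolate b a := by
  funext z
  by_cases hab : a = b
  · rw [hab]
  have hne : vertexPos b - vertexPos a ≠ 0 :=
    sub_ne_zero.2 fun h => hab (vertexPos_injective h).symm
  have hn : ‖vertexPos b - vertexPos a‖ ^ 2 ≠ 0 := by positivity
  have h1 : vertexPos a - vertexPos b = -(vertexPos b - vertexPos a) := by ring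
  have h2 : z - vertexPos b = (z - vertexPos a) - (vertexPos b - vertexPos a) := by ring
  rw [interpolate, interpolate, h1, norm_neg, h2, inner_neg_right,
    inner_sub_left (z - vertexPos a), real_inner_self_eq_norm_sq]
  field_simp
  ring

theorem continuous_interpolate (a b : Fin 6) : Continuous (interpolate a b) := by
  unfold interpolate
  fun_prop

/-- The final heights: the edge `13` lies in the plane; the edge `46` is bent where it passes
through the plane, between the chord `15` and the vertex `6`; the other edges are straight. At the
point of the chord `46` that divides it in the ratio `u : 1 - u`, the two pieces of the bent edge
have heights `1 - 6 * u / 5` and `5 - 6 * u`, so that the bend is at `u = 5 / 6`. -/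
noncomputable def finalHeight (e : Sym2 (Fin 6)) : ℂ → ℝ :=
  if e = s(1, 3) then 0
  else if e = s(4, 0) then fun z =>
    min ((1 - 2 * hexX z - 4 * hexY z) / 5) (1 - 2 * hexX z - 4 * hexY z)
  else Sym2.lift ⟨interpolate, interpolate_comm⟩ e

theorem finalHeight_mk {a b : Fin 6} (h : s(a, b) ≠ s(1, 3)) (h' : s(a, b) ≠ s(4, 0)) :
    finalHeight s(a, b) = interpolate a b := by
  rw [finalHeight, if_neg h, if_neg h', Sym2.lift_mk]

theorem continuous_finalHeight (e : Sym2 (Fin 6)) : Continuous (finalHeight e) := by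
  have := continuous_hexX
  have := continuous_hexY
  unfold finalHeight
  split_ifs
  · exact continuous_const
  · fun_prop
  · induction e with | _ a b => exact continuous_interpolate a b

/-- The heights that the vertical shear by `lift` turns into the final ones. -/
noncomputable def flatHeight (e : Sym2 (Fin 6)) (z : ℂ) : ℝ := finalHeight e z - lift z

/-- The position of an edge relative to the horizontal plane: above (`2`), inside (`1`) or
below (`0`). -/
def level (e : Sym2 (Fin 6)) : ℕ :=
  if e = s(1, 4) ∨ e = s(2, 4) ∨ e = s(4, 0) then 2
  else if e = s(0, 2) ∨ e = s(0, 3) then 0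
  else 1

theorem flatHeight_vertexPos {e : Sym2 (Fin 6)} {k : Fin 6} (hk : k ∈ e) :
    flatHeight e (vertexPos k) = 0 := by
  rw [flatHeight, lift_vertexPos]
  by_cases h : e = s(1, 3)
  · subst h
    rcases Sym2.mem_iff.1 hk with rfl | rfl <;> simp [finalHeight, vz]
  by_cases h' : e = s(4, 0)
  · subst h'
    rw [finalHeight, if_neg h, if_pos rfl]
    rcases Sym2.mem_iff.1 hk with rfl | rfl <;> simp only [hexX_vertexPos, hexY_vertexPos] <;>
      simp [vx, vy, vz] <;> norm_num
  · induction e with | _ a b =>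
    rw [finalHeight_mk h h']
    have h0 := interpolate_chordPoint a b 0
    have h1 := interpolate_chordPoint a b 1
    rw [chordPoint_zero] at h0
    rw [chordPoint_one] at h1
    rcases Sym2.mem_iff.1 hk with rfl | rfl
    · rw [h0]; ring
    · rw [h1]; ring

theorem lift_chordPoint (a b : Fin 6) (s : ℝ) : lift (chordPoint a b s) =
    max 0 (-((1 - s) * vx a + s * vx b) - 2 * ((1 - s) * vy a + s * vy b) - 1) -
      max 0 (2 * ((1 - s) * vx a + s * vx b) + ((1 - s) * vy a + s * vy b) - 1) := by
  rw [lift, hexX_chordPoint, hexY_chordPoint]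

/-- At interior points, the level of an interior edge other than `13` tells the sign of its height
before the lift. -/
theorem flatHeight_sign {a b : Fin 6} {s : ℝ} (h0 : 0 < s) (h1 : s < 1) :
    ((a = 1 ∧ b = 4) ∨ (a = 2 ∧ b = 4) ∨ (a = 4 ∧ b = 0) →
      0 < flatHeight s(a, b) (chordPoint a b s)) ∧
    ((a = 0 ∧ b = 2) ∨ (a = 0 ∧ b = 3) → flatHeight s(a, b) (chordPoint a b s) < 0) ∧
    ((a = 1 ∧ b = 5) ∨ (a = 2 ∧ b = 5) ∨ (a = 3 ∧ b = 5) →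
      flatHeight s(a, b) (chordPoint a b s) = 0) := by
  refine ⟨?_, ?_, ?_⟩
  · rintro (⟨rfl, rfl⟩ | ⟨rfl, rfl⟩ | ⟨rfl, rfl⟩)
    · rw [flatHeight, finalHeight_mk (by decide) (by decide), interpolate_chordPoint,
        lift_chordPoint]
      simp [vx, vy, vz]
      grind
    · rw [flatHeight, finalHeight_mk (by decide) (by decide), interpolate_chordPoint,
        lift_chordPoint]
      simp [vx, vy, vz]
      grind
    · rw [flatHeight, finalHeight, if_neg (by decide), if_pos rfl, lift_chordPoint]
      simp only [hexX_chordPoint, hexY_chordPoint]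
      simp [vx, vy]
      grind
  · rintro (⟨rfl, rfl⟩ | ⟨rfl, rfl⟩) <;>
    · rw [flatHeight, finalHeight_mk (by decide) (by decide), interpolate_chordPoint,
        lift_chordPoint]
      simp [vx, vy, vz]
      grind
  · rintro (⟨rfl, rfl⟩ | ⟨rfl, rfl⟩ | ⟨rfl, rfl⟩) <;>
    · rw [flatHeight, finalHeight_mk (by decide) (by decide), interpolate_chordPoint,
        lift_chordPoint]
      simp [vx, vy, vz]
      grind

theorem flatHeight_sign_of_cross {e f : Sym2 (Fin 6)} (h : Cross e f) (he : e ≠ s(1, 3)) {p : ℂ}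
    (hp : p ∈ chord e) (hp1 : ‖p‖ < 1) :
    (level e = 0 ∧ flatHeight e p < 0) ∨ (level e = 1 ∧ flatHeight e p = 0) ∨
      (level e = 2 ∧ 0 < flatHeight e p) := by
  obtain ⟨a, b, c, d, rfl, rfl, h⟩ := h
  have interior : ∀ a b c d : Fin 6, Separates a b c d → s(a, b) ≠ s(1, 3) →
      s(a, b) = s(1, 4) ∨ s(a, b) = s(2, 4) ∨ s(a, b) = s(4, 0) ∨ s(a, b) = s(0, 2) ∨
      s(a, b) = s(0, 3) ∨ s(a, b) = s(1, 5) ∨ s(a, b) = s(2, 5) ∨ s(a, b) = s(3, 5) := by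
    decide +kernel
  have hs : ∀ a' b' : Fin 6, p ∈ chord s(a', b') →
      ∃ s, 0 < s ∧ s < 1 ∧ p = chordPoint a' b' s := by
    intro a' b' hp
    rw [chord_mk] at hp
    obtain ⟨s, hs, rfl⟩ := hp
    refine ⟨s, hs.1.lt_of_ne ?_, hs.2.lt_of_ne ?_, rfl⟩
    · rintro rfl
      rw [chordPoint_zero, norm_vertexPos] at hp1
      exact lt_irrefl _ hp1
    · rintro rfl
      rw [chordPoint_one, norm_vertexPos] at hp1
      exact lt_irrefl _ hp1
  rcases interior a b c d h he with h | h | h | h | h | h | h | h <;> rw [h] at hp ⊢ <;>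
    obtain ⟨s, h0, h1, rfl⟩ := hs _ _ hp
  · exact Or.inr (Or.inr ⟨by decide, (flatHeight_sign h0 h1).1 (by simp)⟩)
  · exact Or.inr (Or.inr ⟨by decide, (flatHeight_sign h0 h1).1 (by simp)⟩)
  · exact Or.inr (Or.inr ⟨by decide, (flatHeight_sign h0 h1).1 (by simp)⟩)
  · exact Or.inl ⟨by decide, (flatHeight_sign h0 h1).2.1 (by simp)⟩
  · exact Or.inl ⟨by decide, (flatHeight_sign h0 h1).2.1 (by simp)⟩
  · exact Or.inr (Or.inl ⟨by decide, (flatHeight_sign h0 h1).2.2 (by simp)⟩)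
  · exact Or.inr (Or.inl ⟨by decide, (flatHeight_sign h0 h1).2.2 (by simp)⟩)
  · exact Or.inr (Or.inl ⟨by decide, (flatHeight_sign h0 h1).2.2 (by simp)⟩)

theorem rankedHeights_flatHeight : RankedHeights {e | e ≠ s(1, 3)} level flatHeight where
  continuousOn e _ := ((continuous_finalHeight e).sub continuous_lift).continuousOn
  vertex e _ k hk := flatHeight_vertexPos hk
  lt e he f hf hc hlt p hpe hpf hp := by
    rcases flatHeight_sign_of_cross hc he hpe hp with h | h | h <;>
      rcases flatHeight_sign_of_cross hc.symm hf hpf hp with h' | h' | h' <;>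
      first | omega | linarith

/-- Once `13` is out of the way, the ranking by the canonical sheets and that by levels order all
crossing pairs of edges in the same way. -/
theorem level_lt_level {e f : Sym2 (Fin 6)} (h : Cross e f) (he : e ≠ s(1, 3))
    (hf : f ≠ s(1, 3)) : level e ≠ level f ∧
      (level e < level f → canonicalSheet f < canonicalSheet e) := by
  obtain ⟨a, b, c, d, rfl, rfl, h⟩ := h
  have key : ∀ a b c d : Fin 6, Separates a b c d → s(a, b) ≠ s(1, 3) → s(c, d) ≠ s(1, 3) →
      level s(a, b) ≠ level s(c, d) ∧
      (level s(a, b) < level s(c, d) → canonicalSheet s(c, d) < canonicalSheet s(a, b)) := by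
    decide +kernel
  exact key a b c d h he hf

theorem rankedHeights_shearedHeight : RankedHeights {e | e ≠ s(1, 3)} level shearedHeight where
  continuousOn e he := by
    simp only [shearedHeight, if_neg (show e ≠ s(1, 3) from he)]
    exact (continuous_bowl e).continuousOn
  vertex e he k _ := by
    simp only [shearedHeight, if_neg (show e ≠ s(1, 3) from he), bowl_vertexPos]
  lt e he f hf hc hlt p _ _ hp := by
    simp only [shearedHeight, if_neg (show e ≠ s(1, 3) from he),
      if_neg (show f ≠ s(1, 3) from hf)]
    exact bowl_lt ((level_lt_level hc he hf).2 hlt) hp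

theorem shearedHeight_vertexPos {e : Sym2 (Fin 6)} {k : Fin 6} (hk : k ∈ e) :
    shearedHeight e (vertexPos k) = 0 := by
  by_cases he : e = s(1, 3)
  · subst he
    simp only [shearedHeight, if_true, hexX_vertexPos, hexY_vertexPos]
    rcases Sym2.mem_iff.1 hk with rfl | rfl <;> simp [vx, vy]
  · exact rankedHeights_shearedHeight.vertex e he k hk

theorem drawing_of_ne {e : Sym2 (Fin 6)} (he : e ≠ s(1, 3)) : drawing e = chord e := if_neg he

theorem isCompact_drawing (e : Sym2 (Fin 6)) : IsCompact (drawing e) := by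
  unfold drawing
  split_ifs
  exacts [isCompact_outerPath, isCompact_chord e]

theorem drawing_nonempty (e : Sym2 (Fin 6)) : (drawing e).Nonempty := by
  unfold drawing
  split_ifs
  exacts [(chord_nonempty _).image _, chord_nonempty e]

/-- The outer path meets the chords only at the vertices `1` and `3`, so that the edge `13` imposes
no condition on the order. -/
theorem sheared_isotopic_flat : FamilyIsotopic (fun e => arc (drawing e) (shearedHeight e))
    (fun e => arc (drawing e) (flatHeight e)) := by
  have outer : ∀ f : Sym2 (Fin 6), f ≠ s(1, 3) → ∀ p ∈ drawing s(1, 3), p ∈ drawing f →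
      ∃ k ∈ (s(1, 3) : Sym2 (Fin 6)), k ∈ f ∧ p = vertexPos k := by
    intro f hf p hp hpf
    rw [drawing_of_ne hf] at hpf
    rw [drawing, if_pos rfl] at hp
    have hp1 : ‖p‖ ≤ 1 := by simpa using chord_subset_closedBall f hpf
    rcases vertex_of_mem_outerPath hp hp1 with rfl | rfl
    · exact ⟨1, by simp, mem_of_vertexPos_mem_chord hpf, rfl⟩
    · exact ⟨3, by simp, mem_of_vertexPos_mem_chord hpf, rfl⟩
  refine familyIsotopic_of_compatible (r := level) isCompact_drawing drawing_nonempty ?_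
    (fun e => ((continuous_finalHeight e).sub continuous_lift).continuousOn) ?_
  · intro e
    by_cases he : e = s(1, 3)
    · simp only [shearedHeight, if_pos he]
      have := continuous_hexX
      have := continuous_hexY
      fun_prop
    · rw [drawing_of_ne he]
      exact rankedHeights_shearedHeight.continuousOn e he
  · intro e f hef p hpe hpf
    have vertex : ∀ k ∈ e, k ∈ f → p = vertexPos k →
        Compatible level shearedHeight flatHeight e f p := by
      rintro k hke hkf rfl
      exact .of_vertex (shearedHeight_vertexPos hke) (shearedHeight_vertexPos hkf)
        (flatHeight_vertexPos hke) (flatHeight_vertexPos hkf)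
    by_cases he : e = s(1, 3)
    · subst he
      obtain ⟨k, hk, hkf, h⟩ := outer f hef.symm p hpe hpf
      exact vertex k hk hkf h
    by_cases hf : f = s(1, 3)
    · subst hf
      obtain ⟨k, hk, hke, h⟩ := outer e he p hpf hpe
      exact vertex k hke hk h
    rw [drawing_of_ne he] at hpe
    rw [drawing_of_ne hf] at hpf
    exact rankedHeights_shearedHeight.compatible rankedHeights_flatHeight he hf
      (fun hc => (level_lt_level hc he hf).1) hef hpe hpf

theorem flat_isotopic_final : FamilyIsotopic (fun e => arc (drawing e) (flatHeight e))
    (fun e => arc (drawing e) (finalHeight e)) := by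
  obtain ⟨H, hH, h⟩ := exists_vertical_shear continuous_lift
  refine ⟨H, hH, fun e => ?_⟩
  simp only [arc, image_image, h, flatHeight, sub_add_cancel]

/-! ### The symmetric model -/

/-- The shear of the upper half-space that takes the vertex `4`, at height `1`, to a position
vertically above the vertex `6`. -/
noncomputable def slide (x : Space) : Space :=
  (x.1 + max x.2 0 • (vertexPos (0 : Fin 6) - vertexPos (4 : Fin 6)), x.2)

/-- A spatial graph that is symmetric with respect to the horizontal plane. -/
noncomputable def model (e : Sym2 (Fin 6)) : Set Space := slide '' arc (drawing e) (finalHeight e)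

theorem canonical_isotopic_model (F : SheetStack 3) :
    FamilyIsotopic (sheetFamily canonicalSheet F) model := by
  have h1 : FamilyIsotopic (sheetFamily canonicalSheet F)
      fun e => arc (chord e) (raisedHeight e) :=
    (rankedHeights_sheet canonicalSheet F fun e f _ hlt => by
      rw [Fin.lt_def]; omega).familyIsotopic rankedHeights_raisedHeight fun e f h heq =>
        canonicalSheet_admissible e f h (Fin.ext (by omega))
  refine (((h1.trans raised_isotopic_sheared).trans sheared_isotopic_flat).trans
    flat_isotopic_final).trans ?_
  obtain ⟨H, hH, h⟩ := exists_horizontal_shear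
    (f := fun t => max t 0 • (vertexPos (0 : Fin 6) - vertexPos (4 : Fin 6))) (by fun_prop)
  refine ⟨H, hH, fun e => ?_⟩
  simp only [model, h]
  rfl

theorem model_outer : model s(1, 3) = arc outerPath 0 := by
  simp only [model, drawing, finalHeight, if_true, arc, image_image, slide]
  simp

/-- Except for `13` and `46`, the edges of the model are the straight segments between its
vertices. -/
theorem model_mk {a b : Fin 6} (h : s(a, b) ≠ s(1, 3)) (h' : s(a, b) ≠ s(4, 0)) :
    model s(a, b) = (fun s : ℝ =>
      (((1 - s) • vertexPos (if a = 4 then 0 else a) + s • vertexPos (if b = 4 then 0 else b),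
        (1 - s) * vz a + s * vz b) : Space)) '' Icc 0 1 := by
  rw [model, drawing_of_ne h, finalHeight_mk h h', chord_mk]
  simp only [arc, image_image, slide, interpolate_chordPoint]
  refine image_congr fun s hs => ?_
  have key : ∀ a b : Fin 6, s(a, b) ≠ s(4, 0) → (0 ≤ vz a ∧ 0 ≤ vz b) ∨ (vz a ≤ 0 ∧ vz b ≤ 0) := by
    decide
  have hmax : max ((1 - s) * (vz a : ℝ) + s * vz b) 0
      = (1 - s) * max (vz a : ℝ) 0 + s * max (vz b : ℝ) 0 := by
    have hs0 := hs.1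
    have hs1 := sub_nonneg.2 hs.2
    rcases key a b h' with ⟨ha, hb⟩ | ⟨ha, hb⟩
    · have ha' : (0 : ℝ) ≤ vz a := by exact_mod_cast ha
      have hb' : (0 : ℝ) ≤ vz b := by exact_mod_cast hb
      rw [max_eq_left ha', max_eq_left hb', max_eq_left (by positivity)]
    · have ha' : (vz a : ℝ) ≤ 0 := by exact_mod_cast ha
      have hb' : (vz b : ℝ) ≤ 0 := by exact_mod_cast hb
      rw [max_eq_right ha', max_eq_right hb', max_eq_right (by nlinarith)]
      ring
  have hw : ∀ k : Fin 6, vertexPos (if k = 4 then 0 else k)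
      = vertexPos k + max (vz k : ℝ) 0 • (vertexPos (0 : Fin 6) - vertexPos (4 : Fin 6)) := by
    intro k
    fin_cases k <;> simp [vz]
  rw [hmax, hw a, hw b, chordPoint]
  congr 1
  module

/-- After the slide, the two straight pieces of the bent edge `46` are parametrised symmetrically
by the height. -/
theorem model_bent : model s(4, 0) = (fun t : ℝ => ((vertexPos (0 : Fin 6) +
    ((1 - |t|) / 6) • (vertexPos (4 : Fin 6) - vertexPos (0 : Fin 6)), t) : Space)) ''
      Icc (-1) 1 := by
  have hz : ∀ u : ℝ, finalHeight s(4, 0) (chordPoint 4 0 u) = min (1 - 6 * u / 5) (5 - 6 * u) := by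
    intro u
    rw [finalHeight, if_neg (by decide), if_pos rfl]
    simp only [hexX_chordPoint, hexY_chordPoint]
    simp only [vx, vy, Matrix.cons_val]
    congr 1 <;> push_cast <;> ring
  have hslide : ∀ u t : ℝ, 1 - u - max t 0 = (1 - |t|) / 6 →
      slide (chordPoint 4 0 u, t) = (vertexPos (0 : Fin 6) +
        ((1 - |t|) / 6) • (vertexPos (4 : Fin 6) - vertexPos (0 : Fin 6)), t) := by
    intro u t h
    rw [← h, slide, chordPoint]
    congr 1
    module
  rw [model, drawing_of_ne (by decide), chord_mk]
  simp only [arc, image_image, hz]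
  ext x
  constructor
  · rintro ⟨u, hu, rfl⟩
    refine ⟨min (1 - 6 * u / 5) (5 - 6 * u), ⟨?_, ?_⟩, (hslide _ _ ?_).symm⟩
    · exact le_min (by linarith [hu.2]) (by linarith [hu.2])
    · exact (min_le_left _ _).trans (by linarith [hu.1])
    · rcases le_total u (5 / 6) with h | h
      · rw [min_eq_left (by linarith), max_eq_left (by linarith), abs_of_nonneg (by linarith)]
        ring
      · rw [min_eq_right (by linarith), max_eq_right (by linarith), abs_of_nonpos (by linarith)]
        ring
  · rintro ⟨t, ht, rfl⟩
    rcases le_total 0 t with h | h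
    · refine ⟨5 * (1 - t) / 6, ⟨by linarith [ht.2], by linarith⟩, ?_⟩
      have e : min (1 - 6 * (5 * (1 - t) / 6) / 5) (5 - 6 * (5 * (1 - t) / 6)) = t := by
        rw [min_eq_left (by linarith)]; ring
      beta_reduce
      rw [e]
      refine hslide _ _ ?_
      rw [max_eq_left h, abs_of_nonneg h]; ring
    · refine ⟨(5 - t) / 6, ⟨by linarith, by linarith [ht.1]⟩, ?_⟩
      have e : min (1 - 6 * ((5 - t) / 6) / 5) (5 - 6 * ((5 - t) / 6)) = t := by
        rw [min_eq_right (by linarith)]; ring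
      beta_reduce
      rw [e]
      refine hslide _ _ ?_
      rw [max_eq_right h, abs_of_nonpos h]; ring

/-- The reflection in the horizontal plane exchanges the vertices `4` and `6` of the model. -/
theorem mirror_model (e : Sym2 (Fin 6)) :
    (fun x : Space => ((x.1, -x.2) : Space)) '' model e = model (e.map (Equiv.swap 4 0)) := by
  by_cases h : e = s(1, 3)
  · subst h
    have : (s(1, 3) : Sym2 (Fin 6)).map (Equiv.swap 4 0) = s(1, 3) := by decide
    rw [this, model_outer]
    simp [arc, image_image]
  by_cases h' : e = s(4, 0)
  · subst h'
    have : (s(4, 0) : Sym2 (Fin 6)).map (Equiv.swap 4 0) = s(4, 0) := by decide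
    rw [this, model_bent, image_image]
    ext x
    constructor
    · rintro ⟨t, ht, rfl⟩
      exact ⟨-t, ⟨by linarith [ht.2], by linarith [ht.1]⟩, by simp⟩
    · rintro ⟨t, ht, rfl⟩
      exact ⟨-t, ⟨by linarith [ht.2], by linarith [ht.1]⟩, by simp⟩
  · induction e with | _ a b =>
    have key : ∀ a b : Fin 6, s(a, b) ≠ s(1, 3) → s(a, b) ≠ s(4, 0) →
        s(Equiv.swap 4 0 a, Equiv.swap 4 0 b) ≠ s(1, 3) ∧
        s(Equiv.swap 4 0 a, Equiv.swap 4 0 b) ≠ s(4, 0) := by decide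
    have hz : ∀ k : Fin 6, vz (Equiv.swap 4 0 k) = -vz k := by decide
    have hw : ∀ k : Fin 6, (if Equiv.swap 4 0 k = 4 then 0 else Equiv.swap 4 0 k)
        = if k = 4 then 0 else k := by decide
    rw [Sym2.map_mk, model_mk h h', model_mk (key a b h h').1 (key a b h h').2, image_image]
    refine image_congr fun s _ => ?_
    simp only [hz, hw, Prod.mk.injEq, true_and]
    push_cast
    ring

theorem canonicalAchiral : CanonicalAchiral := by
  intro F
  have h := (canonical_isotopic_model F).ambientIsotopic
  have hm : (SpatialGraph.ofFamily model).mirror = SpatialGraph.ofFamily model := by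
    rw [SpatialGraph.mirror, SpatialGraph.map_ofFamily]
    simp only [mirror_model]
    exact SpatialGraph.ofFamily_relabel model (Equiv.swap 4 0)
  have h' := h.mirror
  rw [hm] at h'
  exact h.trans h'.symm

end BookRep

theorem mainTheorem2 :
    -- every 3-sheet book representation is ambient isotopic to the canonical one
    (∀ (B : BookRep.BookRepresentation 6 3) (F F' : BookRep.SheetStack 3),
      BookRep.AmbientIsotopic (B.spatialGraph F) (BookRep.canonicalK6.spatialGraph F')) ∧
    -- three is the minimal number of sheets
    IsLeast {s : ℕ | Nonempty (BookRep.BookRepresentation 6 s)} 3 ∧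
    -- the canonical representation is achiral
    (∀ F : BookRep.SheetStack 3,
      BookRep.AmbientIsotopic (BookRep.canonicalK6.spatialGraph F)
        (BookRep.canonicalK6.spatialGraph F).mirror) := by
  refine ⟨BookRep.ambientIsotopic_canonicalK6 BookRep.canonicalAchiral, BookRep.isLeast_sheets,
    fun F => ?_⟩
  rw [BookRep.canonicalK6_spatialGraph]
  exact BookRep.canonicalAchiral F
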